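/- Let $\Sigma$ be a finite alphabet. A 2QCFA (two-way finite automaton with quantum and classical states) over $\Sigma$ has a finite set $Q$ of quantum basis states, a finite set $C$ of classical states containing a start state $c_{start}$ and halting states $c_{acc}\neq c_{rej}$, a quantum start state $q_{start}\in Q$, and a finite set $R$ of measurement results. On input $w\in\Sigma^*$ it has a two-way read-only tape $\#_L w\,\#_R$; it starts in $c_{start}$ with quantum register $|q_{start}\rangle\in\mathbb{C}^Q$ and with the head on $\#_L$ (a move off either end of the tape leaves the head in place). In each step, depending on the current non-halting classical state $c$ and scanned symbol $\sigma$, it performs a selective quantum operation on the register, given by arbitrary complex operators $E_{r,j}$ ($r\in R$, $1\le j\le |Q|^2$) with $\sum_{r,j}E_{r,j}^\dagger E_{r,j}=1$: with $\Phi_r(A)=\sum_j E_{r,j}AE_{r,j}^\dagger$, a register in the state described by a density operator $A$ yields result $r$ with probability $\mathrm{Tr}\,\Phi_r(A)$ and is then described by $\Phi_r(A)/\mathrm{Tr}\,\Phi_r(A)$. The new classical state and the head movement in $\{-1,0,1\}$ are determined by $(c,\sigma,r)$. Let $\mathsf{BQP2QCFA}$ be the class of languages $L\subseteq\Sigma^*$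 for which there are a 2QCFA $N$, an $\epsilon\in[0,\tfrac12)$ and a function $T:\mathbb{N}\to\mathbb{N}$ with $T(n)=n^{O(1)}$ such that $\Pr[N\text{ accepts }w]\ge 1-\epsilon$ for all $w\in L$, $\Pr[N\text{ accepts }w]\le\epsilon$ for all $w\in\Sigma^*\setminus L$, and, for every $n$, the expected running time of $N$ is at most $T(n)$ on every input of length at most $n$. For $L\subseteq\Sigma^*$ and $n\in\mathbb{N}$, strings $x,x'\in\Sigma^*$ of length at most $n$ are $(L,n)$-dissimilar if there is a $y\in\Sigma^*$ with $|y|\le n-\max(|x|,|x'|)$ such that exactly one of $xy$, $x'y$ is in $L$. Let $D_L(n)$ be the largest $h$ such that there are $h$ pairwise $(L,n)$-dissimilar strings of length at most $n$. Let $\mathsf{L/poly}$ be the class of languages decided by a deterministic Turing machine that has a read-only input tape and, on inputs of length $n$, uses $O(\log n)$ cells of its work tape and has read-only access to an advice string $y_n\in\{0,1\}^*$ that depends only on $n$ and has length $n^{O(1)}$. Then every $L\in\mathsf{BQP2QCFA}$ satisfies $D_L(n)=n^{O(1)}$. Moreover, $\mathsf{BQP2QCFA}\subseteq\mathsf{L/poly}$.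 -/

import Mathlib

/-- The tape alphabet `α ⊔ {#_L, #_R}`: an input symbol or one of the two end-markers. -/
inductive TapeSymbol (α : Type*) where
  | leftEnd : TapeSymbol α
  | rightEnd : TapeSymbol α
  | symbol (a : α) : TapeSymbol α

/-- The contents of cell `h` of the read-only tape `#_L w #_R`, whose cells are numbered
`0, …, |w| + 1`. -/
def tapeAt {α : Type*} (w : List α) (h : Fin (w.length + 2)) : TapeSymbol α :=
  if (h : ℕ) = 0 then .leftEnd
  else match w[(h : ℕ) - 1]? with
    | some a => .symbol a
    | none => .rightEnd

/-- The new head position on a tape with cells `0, …, m`, after a move in direction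
`-1` (left), `0` (stay) or `1` (right). A head that is told to leave the tape stays put. -/
def moveHead {m : ℕ} (d : SignType) (h : Fin (m + 1)) : Fin (m + 1) :=
  match d with
  | .neg => ⟨(h : ℕ) - 1, by omega⟩
  | .zero => h
  | .pos => ⟨min ((h : ℕ) + 1) m, by omega⟩

/-! ### Two-way finite automata with quantum and classical states -/

/-- A selective quantum operation on the register `ℂ^Q` with results in `R`, given by operators
`E r j`, for `r ∈ R` and `1 ≤ j ≤ |Q|²`, with `∑ r j, (E r j)† (E r j) = 1`. -/
structure SelectiveOperation (Q R : Type) [Fintype Q] [DecidableEq Q] [Fintype R] where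
  E : R → Fin (Fintype.card Q ^ 2) → Matrix Q Q ℂ
  complete : ∑ r, ∑ j, (E r j).conjTranspose * E r j = 1

/-- The map `Φ_r(A) = ∑ j, (E r j) A (E r j)†`. If the register is described by the density
operator `A`, the result is `r` with probability `Tr (Φ_r(A))`, and the register is then described
by `Φ_r(A) / Tr (Φ_r(A))`. -/
def SelectiveOperation.branch {Q R : Type} [Fintype Q] [DecidableEq Q] [Fintype R]
    (F : SelectiveOperation Q R) (r : R) (A : Matrix Q Q ℂ) : Matrix Q Q ℂ :=
  ∑ j, F.E r j * A * (F.E r j).conjTranspose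

/-- A two-way finite automaton with quantum and classical states (2QCFA) with input alphabet `α`:
`Q` are the quantum basis states, `C` the classical states, `R` the possible results of the
selective quantum operations, `θ` and `δ` the quantum and classical parts of the transition
function, which are defined on the non-halting classical states. -/
structure TwoQCFA (α : Type*) where
  Q : Type
  C : Type
  R : Type
  [fintypeQ : Fintype Q]
  [fintypeC : Fintype C]
  [fintypeR : Fintype R]
  [decEqQ : DecidableEq Q]
  [decEqC : DecidableEq C]
  qStart : Q
  cStart : C
  cAcc : C
  cRej : C
  acc_ne_rej : cAcc ≠ cRej
  θ : {c : C // c ≠ cAcc ∧ c ≠ cRej} → TapeSymbol α → SelectiveOperation Q R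
  δ : {c : C // c ≠ cAcc ∧ c ≠ cRej} → TapeSymbol α → R → C × SignType

namespace TwoQCFA

attribute [instance] fintypeQ fintypeC fintypeR decEqQ decEqC

variable {α : Type*}

/-- The non-halting classical states. -/
abbrev NonHalting (N : TwoQCFA α) : Type := {c : N.C // c ≠ N.cAcc ∧ c ≠ N.cRej}

/-- An ensemble of configurations on an input `w`: `Z c h` is `p(c, h) A(c, h)`, where `p(c, h)` is
the probability of being in classical state `c` with the head in position `h`, and `A(c, h)` is
the density operator that describes the register in that case. Thus `Tr (Z c h) = p(c, h)`. -/
abbrev Ensemble (N : TwoQCFA α) (w : List α) : Type :=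
  N.C → Fin (w.length + 2) → Matrix N.Q N.Q ℂ

/-- The initial ensemble: classical state `cStart`, register in the pure state `|qStart⟩`, head over
the left end-marker. -/
def initial (N : TwoQCFA α) (w : List α) : N.Ensemble w := fun c h =>
  if c = N.cStart ∧ h = 0 then Matrix.single N.qStart N.qStart 1 else 0

/-- One step of the computation. In a configuration with non-halting classical state `c` and with
the head over `σ`, the operation `θ(c, σ)` is performed; if its result is `r` then
`δ(c, σ, r)` gives the new classical state and the head movement. Halted branches do not change. -/
def step (N : TwoQCFA α) (w : List α) (Z : N.Ensemble w) : N.Ensemble w := fun c' h' =>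
  (if c' = N.cAcc ∨ c' = N.cRej then Z c' h' else 0) +
    ∑ c : N.NonHalting, ∑ h : Fin (w.length + 2), ∑ r : N.R,
      if (N.δ c (tapeAt w h) r).1 = c' ∧ moveHead (N.δ c (tapeAt w h) r).2 h = h' then
        (N.θ c (tapeAt w h)).branch r (Z c h)
      else 0

/-- The ensemble after `t` steps on input `w`. -/
def ensembleAt (N : TwoQCFA α) (w : List α) (t : ℕ) : N.Ensemble w :=
  (N.step w)^[t] (N.initial w)

/-- The probability of being in classical state `c` after `t` steps on input `w`. -/
def stateProb (N : TwoQCFA α) (w : List α) (t : ℕ) (c : N.C) : ℝ :=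
  ∑ h, (N.ensembleAt w t c h).trace.re

/-- `Pr[N accepts w]`: the supremum (which is the limit) over `t` of the probability that `N` has
accepted `w` within `t` steps. -/
noncomputable def acceptProb (N : TwoQCFA α) (w : List α) : ℝ :=
  ⨆ t, N.stateProb w t N.cAcc

/-- The probability that `N` performs more than `t` steps on input `w`, that is, that it has not
halted within `t` steps. -/
def runsLongerProb (N : TwoQCFA α) (w : List α) (t : ℕ) : ℝ :=
  ∑ c : N.NonHalting, N.stateProb w t c

/-- The expected running time of `N` on `w`, as the sum over `t` of the probability that the running
time exceeds `t`; it is infinite if `N` runs forever with positive probability. -/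
noncomputable def expectedTime (N : TwoQCFA α) (w : List α) : ENNReal :=
  ∑' t, ENNReal.ofReal (N.runsLongerProb w t)

/-- `N` recognizes `L` with two-sided bounded error `ε`. -/
def Recognizes (N : TwoQCFA α) (L : Language α) (ε : ℝ) : Prop :=
  (∀ w ∈ L, 1 - ε ≤ N.acceptProb w) ∧ ∀ w ∉ L, N.acceptProb w ≤ ε

end TwoQCFA

/-- The languages over `α` that some 2QCFA with at most `k` quantum basis states and at most `d`
classical states recognizes with two-sided bounded error `ε`, with expected running time at most
`T n` on all inputs of length at most `n`, for every `n`. -/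
def B2QCFA (α : Type*) (k d : ℕ) (T : ℕ → ℕ) (ε : ℝ) : Set (Language α) :=
  {L | ∃ N : TwoQCFA α, Fintype.card N.Q ≤ k ∧ Fintype.card N.C ≤ d ∧ N.Recognizes L ε ∧
    ∀ (n : ℕ) (w : List α), w.length ≤ n → N.expectedTime w ≤ (T n : ENNReal)}

/-- The languages recognizable with two-sided bounded error by a 2QCFA in expected time at most
`T n`. -/
def B2QCFATime (α : Type*) (T : ℕ → ℕ) : Set (Language α) :=
  {L | ∃ (k d : ℕ) (ε : ℝ), 2 ≤ k ∧ 2 ≤ d ∧ 0 ≤ ε ∧ ε < 1 / 2 ∧ L ∈ B2QCFA α k d T ε}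

/-- `f(n) = n^{O(1)}`. -/
def IsPolyBounded (f : ℕ → ℕ) : Prop :=
  ∃ c : ℕ, ∀ᶠ n in Filter.atTop, f n ≤ n ^ c

/-- The languages recognizable with two-sided bounded error by a 2QCFA in expected polynomial
time. -/
def BQP2QCFA (α : Type*) : Set (Language α) :=
  {L | ∃ T : ℕ → ℕ, IsPolyBounded T ∧ L ∈ B2QCFATime α T}

/-! ### Nonregularity -/

/-- `x` and `x'`, of length at most `n`, are `(L, n)`-dissimilar: they are told apart by some `y`
of length at most `n - max |x| |x'|`. -/
def Dissimilar {α : Type*} (L : Language α) (n : ℕ) (x x' : List α) : Prop :=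
  ∃ y : List α, max x.length x'.length + y.length ≤ n ∧ (x ++ y ∈ L ↔ x' ++ y ∉ L)

/-- The nonregularity `D_L(n)`: the largest `h` such that there are `h` pairwise
`(L, n)`-dissimilar strings of length at most `n`. -/
noncomputable def nonregularity {α : Type*} (L : Language α) (n : ℕ) : ℕ :=
  sSup {h : ℕ | ∃ x : Fin h → List α, (∀ i, (x i).length ≤ n) ∧
    ∀ i j, i ≠ j → Dissimilar L n (x i) (x j)}

/-! ### Logarithmic space with polynomial advice -/

/-- A deterministic Turing machine with a two-way read-only input tape and a two-way read-only
advice tape, both with end-markers, and a one-way infinite read-write work tape with finite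
alphabet `Γ`. The value of `trans` consists of the new state, the symbol written on the work tape,
and the moves of the input head, of the advice head and of the work head. -/
structure AdviceTM (α : Type*) where
  State : Type
  Γ : Type
  [fintypeState : Fintype State]
  [fintypeΓ : Fintype Γ]
  [decEqState : DecidableEq State]
  blank : Γ
  start : State
  acc : State
  rej : State
  acc_ne_rej : acc ≠ rej
  trans : State → TapeSymbol α → TapeSymbol Bool → Γ →
    State × Γ × SignType × SignType × SignType

namespace AdviceTM

attribute [instance] fintypeState fintypeΓ decEqState

variable {α : Type*}

/-- A configuration on input `w` with advice `y`. -/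
structure Config (M : AdviceTM α) (w : List α) (y : List Bool) where
  state : M.State
  inputHead : Fin (w.length + 2)
  adviceHead : Fin (y.length + 2)
  workHead : ℕ
  work : ℕ → M.Γ

/-- The initial configuration: blank work tape, all heads at the left end. -/
def initial (M : AdviceTM α) (w : List α) (y : List Bool) : M.Config w y where
  state := M.start
  inputHead := 0
  adviceHead := 0
  workHead := 0
  work := fun _ => M.blank

/-- The new position of a head on the one-way infinite work tape; in cell `0` a move to the left
has no effect. -/
def moveWork (d : SignType) (i : ℕ) : ℕ :=
  match d with
  | .neg => i - 1
  | .zero => i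
  | .pos => i + 1

/-- One step of the computation; halted configurations do not change. -/
def step (M : AdviceTM α) (w : List α) (y : List Bool) (K : M.Config w y) : M.Config w y :=
  if K.state = M.acc ∨ K.state = M.rej then K
  else
    let a := M.trans K.state (tapeAt w K.inputHead) (tapeAt y K.adviceHead) (K.work K.workHead)
    { state := a.1
      inputHead := moveHead a.2.2.1 K.inputHead
      adviceHead := moveHead a.2.2.2.1 K.adviceHead
      workHead := moveWork a.2.2.2.2 K.workHead
      work := Function.update K.work K.workHead a.2.1 }

/-- The configuration after `t` steps. -/
def configAt (M : AdviceTM α) (w : List α) (y : List Bool) (t : ℕ) : M.Config w y :=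
  (M.step w y)^[t] (M.initial w y)

/-- On input `w` with advice `y` the machine only visits the first `s` cells of its work tape. -/
def UsesSpaceAtMost (M : AdviceTM α) (w : List α) (y : List Bool) (s : ℕ) : Prop :=
  ∀ t, (M.configAt w y t).workHead < s

/-- On input `w` with advice `y` the machine halts and accepts. -/
def Accepts (M : AdviceTM α) (w : List α) (y : List Bool) : Prop :=
  ∃ t, (M.configAt w y t).state = M.acc

/-- On input `w` with advice `y` the machine halts and rejects. -/
def Rejects (M : AdviceTM α) (w : List α) (y : List Bool) : Prop :=
  ∃ t, (M.configAt w y t).state = M.rej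

end AdviceTM

/-- The class `L/poly = DSPACE(O(log n)) / 2^{O(log n)}` of languages over `α` decided by a
deterministic Turing machine in space `O(log n)` that has access to an advice string, which depends
only on the length `n` of the input and is itself of length `n^{O(1)}`. -/
def LPoly (α : Type*) : Set (Language α) :=
  {L | ∃ (M : AdviceTM α) (y : ℕ → List Bool) (S : ℕ → ℕ),
    IsPolyBounded (fun n => (y n).length) ∧
    (fun n => (S n : ℝ)) =O[Filter.atTop] (fun n : ℕ => Real.log n) ∧
    ∀ w : List α, M.UsesSpaceAtMost w (y w.length) (S w.length) ∧
      (w ∈ L → M.Accepts w (y w.length)) ∧ (w ∉ L → M.Rejects w (y w.length))}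

/-! The argument uses the Heisenberg picture: observables are pulled back along the computation. For
a part of the tape and a bound `t` on the number of steps, `runValue` is a linear map from the
values assigned to the outcomes (halting, or leaving the part) to an observable of the initial
register. It respects the order of quadratic forms and does not increase form bounds.

Cut the tape `#_L x y #_R` between `x` and `y`. A computation alternates between runs inside `#_L x`
and runs inside `y #_R`, so acceptance depends on `x` only through the linear maps for runs in `#_L
x` that begin at the start of the computation or in the last cell. These have a constant number of
complex entries (`transferEntry`), of modulus at most 1. Allow only `t + 1` alternating runs of at
most `t` steps each. Every crossing costs a step, so the resulting acceptance probability lies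
between that of accepting within `t` steps and the full one; by Markov's inequality a cut-off `t`
proportional to the time bound loses only a small constant.

If the entries for `x` and `x'` differ by at most `δ`, these probabilities differ by `O(t δ)` for
every `y`, since errors of successive rounds add up without being amplified. Hence prefixes whose
entries lie in the same box of a grid of mesh about `1 / t` are not dissimilar, and counting boxes
in a space of constant dimension bounds the nonregularity by a polynomial in the time bound.

For the inclusion in L/poly, fix `n` and call the residual of `x` its set of continuations to words
of length `n` in the language. Words of equal length with distinct residuals are dissimilar, so
there are at most `n + 1` times `nonregularity L n` residuals. They are the states of an automaton
that is correct on words of length `n`; a state fits into `O(log n)` bits, and the transition table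
has polynomial size. The advice is this table, written as a straight-line program that a fixed
interpreter executes with the current state on its work tape. -/

/-! ### Quadratic forms of matrices -/

namespace Matrix

open scoped ComplexOrder

variable {Q : Type*} [Fintype Q]

/-- The pointwise order of the (real parts of the) quadratic forms of two matrices. -/
def QuadLE (A B : Matrix Q Q ℂ) : Prop :=
  ∀ v : Q → ℂ, (star v ⬝ᵥ A *ᵥ v).re ≤ (star v ⬝ᵥ B *ᵥ v).re

theorem QuadLE.refl (A : Matrix Q Q ℂ) : A.QuadLE A := fun _ => le_rfl

theorem QuadLE.trans {A B D : Matrix Q Q ℂ} (h : A.QuadLE B) (h' : B.QuadLE D) : A.QuadLE D :=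
  fun v => (h v).trans (h' v)

theorem star_dotProduct_self_re_nonneg (v : Q → ℂ) : 0 ≤ (star v ⬝ᵥ v).re :=
  (Complex.le_def.1 (dotProduct_star_self_nonneg v : (0 : ℂ) ≤ star v ⬝ᵥ v)).1

theorem star_dotProduct_self_re (v : Q → ℂ) : (star v ⬝ᵥ v).re = ∑ q, ‖v q‖ ^ 2 := by
  simp only [dotProduct, Pi.star_apply, Complex.re_sum]
  refine Finset.sum_congr rfl fun q _ => ?_
  rw [← Complex.normSq_eq_norm_sq, Complex.normSq_apply]
  simp

theorem quadLE_zero_one [DecidableEq Q] : (0 : Matrix Q Q ℂ).QuadLE 1 := fun v => by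
  simpa using star_dotProduct_self_re_nonneg v

/-- The sesquilinear form of `A` is bounded by `b` times the mean of the squared norms of its
arguments. -/
def FormBound (b : ℝ) (A : Matrix Q Q ℂ) : Prop :=
  ∀ u v : Q → ℂ, ‖star u ⬝ᵥ A *ᵥ v‖ ≤ b * (((star u ⬝ᵥ u).re + (star v ⬝ᵥ v).re) / 2)

theorem FormBound.add {a b : ℝ} {A B : Matrix Q Q ℂ} (hA : FormBound a A) (hB : FormBound b B) :
    FormBound (a + b) (A + B) := fun u v => by
  rw [add_mulVec, dotProduct_add, add_mul]
  exact (norm_add_le _ _).trans (add_le_add (hA u v) (hB u v))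

theorem FormBound.mono {a b : ℝ} {A : Matrix Q Q ℂ} (hA : FormBound a A) (h : a ≤ b) :
    FormBound b A := fun u v => by
  have := star_dotProduct_self_re_nonneg u
  have := star_dotProduct_self_re_nonneg v
  exact (hA u v).trans (mul_le_mul_of_nonneg_right h (by linarith))

theorem formBound_zero : FormBound 0 (0 : Matrix Q Q ℂ) := fun u v => by simp

theorem FormBound.norm_apply_le [DecidableEq Q] {b : ℝ} {A : Matrix Q Q ℂ} (h : FormBound b A)
    (q q' : Q) : ‖A q q'‖ ≤ b := by
  simpa [mulVec_single, dotProduct, Pi.single_apply, apply_ite] using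
    h (Pi.single q 1) (Pi.single q' 1)

/-- In the sum of the arithmetic-geometric mean inequality over all pairs of indices, each `‖u q‖ ^
2` and each `‖v q'‖ ^ 2` occurs `Fintype.card Q` times. -/
theorem formBound_of_norm_apply_le {δ : ℝ} {A : Matrix Q Q ℂ} (h : ∀ q q', ‖A q q'‖ ≤ δ) :
    FormBound (Fintype.card Q * δ) A := fun u v => by
  rw [star_dotProduct_self_re, star_dotProduct_self_re]
  have h1 : ‖star u ⬝ᵥ A *ᵥ v‖ ≤ ∑ q, ∑ q', δ * ((‖u q‖ ^ 2 + ‖v q'‖ ^ 2) / 2) := by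
    simp only [dotProduct, mulVec, Finset.mul_sum]
    refine (norm_sum_le _ _).trans (Finset.sum_le_sum fun q _ => (norm_sum_le _ _).trans
      (Finset.sum_le_sum fun q' _ => ?_))
    rw [norm_mul, norm_mul, Pi.star_apply, norm_star]
    have h2 : ‖u q‖ * ‖v q'‖ ≤ (‖u q‖ ^ 2 + ‖v q'‖ ^ 2) / 2 := by
      nlinarith [sq_nonneg (‖u q‖ - ‖v q'‖)]
    calc ‖u q‖ * (‖A q q'‖ * ‖v q'‖) = ‖A q q'‖ * (‖u q‖ * ‖v q'‖) := by ring
      _ ≤ _ := mul_le_mul (h q q') h2 (by positivity) ((norm_nonneg _).trans (h q q'))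
  refine h1.trans (le_of_eq ?_)
  simp only [← Finset.mul_sum, ← Finset.sum_div, Finset.sum_add_distrib, Finset.sum_const,
    Finset.card_univ, nsmul_eq_mul]
  ring

end Matrix

/-! ### Selective operations in the Heisenberg picture -/

namespace SelectiveOperation

open Matrix

variable {Q R : Type} [Fintype Q] [DecidableEq Q] [Fintype R] (F : SelectiveOperation Q R)

/-- The dual of a selective operation: the observable whose value before the operation is the
expected value, after the operation with result `r`, of the observable `X r`. -/
def pullback (X : R → Matrix Q Q ℂ) : Matrix Q Q ℂ :=
  ∑ r, ∑ j, (F.E r j).conjTranspose * X r * F.E r j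

theorem pullback_one : F.pullback (fun _ => 1) = 1 := by
  simpa [pullback] using F.complete

theorem sum_trace_branch_mul (A : Matrix Q Q ℂ) (X : R → Matrix Q Q ℂ) :
    ∑ r, (F.branch r A * X r).trace = (A * F.pullback X).trace := by
  simp only [branch, pullback, Matrix.sum_mul, Matrix.mul_sum, Matrix.trace_sum]
  refine Finset.sum_congr rfl fun r _ => Finset.sum_congr rfl fun j _ => ?_
  rw [Matrix.mul_assoc, Matrix.mul_assoc, Matrix.trace_mul_comm]
  simp only [Matrix.mul_assoc]

theorem form_pullback (X : R → Matrix Q Q ℂ) (u v : Q → ℂ) :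
    star u ⬝ᵥ F.pullback X *ᵥ v =
      ∑ r, ∑ j, star (F.E r j *ᵥ u) ⬝ᵥ X r *ᵥ (F.E r j *ᵥ v) := by
  simp only [pullback, Matrix.sum_mulVec, dotProduct_sum]
  refine Finset.sum_congr rfl fun r _ => Finset.sum_congr rfl fun j _ => ?_
  rw [Matrix.star_mulVec, ← Matrix.mulVec_mulVec, ← Matrix.mulVec_mulVec, Matrix.dotProduct_mulVec]

theorem sum_normSq_mulVec (v : Q → ℂ) :
    ∑ r, ∑ j, (star (F.E r j *ᵥ v) ⬝ᵥ (F.E r j *ᵥ v)).re = (star v ⬝ᵥ v).re := by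
  have := congrArg Complex.re (F.form_pullback (fun _ => 1) v v)
  simpa [pullback_one] using this.symm

/-- The form of the pullback at `v` is the sum of the forms of the `X r` at the vectors `F.E r j *ᵥ
v`, so the comparison holds term by term. -/
theorem pullback_quadLE {X Y : R → Matrix Q Q ℂ} (h : ∀ r, (X r).QuadLE (Y r)) :
    (F.pullback X).QuadLE (F.pullback Y) := fun v => by
  simp only [form_pullback, Complex.re_sum]
  exact Finset.sum_le_sum fun r _ => Finset.sum_le_sum fun j _ => h r _

/-- By completeness the squared norms of the vectors `F.E r j *ᵥ u` add up to that of `u`. The mean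
of squared norms in `FormBound` is additive, so no Cauchy–Schwarz inequality over the branches is
needed. -/
theorem formBound_pullback {b : ℝ} {X : R → Matrix Q Q ℂ} (h : ∀ r, FormBound b (X r)) :
    FormBound b (F.pullback X) := fun u v => by
  rw [form_pullback, ← F.sum_normSq_mulVec u, ← F.sum_normSq_mulVec v]
  simp only [← Finset.sum_add_distrib, Finset.sum_div, Finset.mul_sum]
  exact (norm_sum_le _ _).trans (Finset.sum_le_sum fun r _ => (norm_sum_le _ _).trans
    (Finset.sum_le_sum fun j _ => h r _ _))

/-- `pullback` of a family of matrices that depend linearly on a parameter. -/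
def pullbackₗ {V : Type*} [AddCommGroup V] [Module ℂ V] (X : R → V →ₗ[ℂ] Matrix Q Q ℂ) :
    V →ₗ[ℂ] Matrix Q Q ℂ where
  toFun G := F.pullback fun r => X r G
  map_add' G G' := by
    simp [pullback, Matrix.mul_add, Matrix.add_mul, Finset.sum_add_distrib]
  map_smul' a G := by
    simp [pullback, Finset.smul_sum]

@[simp]
theorem pullbackₗ_apply {V : Type*} [AddCommGroup V] [Module ℂ V]
    (X : R → V →ₗ[ℂ] Matrix Q Q ℂ) (G : V) :
    F.pullbackₗ X G = F.pullback fun r => X r G := rfl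

end SelectiveOperation

/-! ### Runs inside a part of the tape -/

/-- A part of a tape: its cells, their contents, and the cell that the head enters after a move,
which is `none` if the head leaves the region. -/
structure TapeRegion (α : Type*) where
  Cell : Type
  symbol : Cell → TapeSymbol α
  move : SignType → Cell → Option Cell

namespace TapeRegion

variable {α : Type*}

/-- The whole tape `#_L w #_R`, which the head never leaves. -/
@[reducible] def whole (w : List α) : TapeRegion α where
  Cell := Fin (w.length + 2)
  symbol := tapeAt w
  move d h := some (moveHead d h)

/-- The part `#_L x` at the left end of a tape. -/
@[reducible] def before (x : List α) : TapeRegion α where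
  Cell := Fin (x.length + 1)
  symbol i := tapeAt x i.castSucc
  move d i :=
    match d with
    | .neg => some ⟨(i : ℕ) - 1, by omega⟩
    | .zero => some i
    | .pos => if h : (i : ℕ) + 1 < x.length + 1 then some ⟨(i : ℕ) + 1, h⟩ else none

/-- The part `y #_R` at the right end of a tape. -/
@[reducible] def after (y : List α) : TapeRegion α where
  Cell := Fin (y.length + 1)
  symbol i :=
    -- The cell numbered `y.length` has no letter and is the right end-marker.
    match y[(i : ℕ)]? with
    | some a => .symbol a
    | none => .rightEnd
  move d i :=
    match d with
    | .neg => if (i : ℕ) = 0 then none else some ⟨(i : ℕ) - 1, by omega⟩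
    | .zero => some i
    | .pos => some ⟨min ((i : ℕ) + 1) y.length, by omega⟩

/-- `e` identifies the region `P` with a part of the region `W`, which the head can leave only into
the cell `b` of `W`. -/
structure IsPart (P W : TapeRegion α) (e : P.Cell → W.Cell) (b : W.Cell) : Prop where
  symbol_eq : ∀ i, W.symbol (e i) = P.symbol i
  move_eq : ∀ d i, W.move d (e i) = some ((P.move d i).elim b e)

/-- The cells of `#_L x`, as cells of `#_L x y #_R`. -/
def beforeCell (x y : List α) (i : (before x).Cell) : (whole (x ++ y)).Cell :=
  ⟨(i : Fin (x.length + 1)), by simp; omega⟩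

/-- The cells of `y #_R`, as cells of `#_L x y #_R`. -/
def afterCell (x y : List α) (i : (after y).Cell) : (whole (x ++ y)).Cell :=
  ⟨x.length + 1 + (i : Fin (y.length + 1)), by simp; omega⟩

theorem before_isPart (x y : List α) :
    (before x).IsPart (whole (x ++ y)) (beforeCell x y)
      (afterCell x y (0 : Fin (y.length + 1))) where
  symbol_eq i := by
    obtain ⟨i, hi⟩ := i
    rcases i with _ | i
    · simp [beforeCell, tapeAt]
    · have h : i < x.length := by omega
      have h' : (x ++ y)[i]? = x[i]? := List.getElem?_append_left h
      simp [beforeCell, tapeAt, h', h]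
  move_eq d i := by
    obtain ⟨i, hi⟩ := i
    rcases d
    · simp [beforeCell, before, whole, moveHead]
    · simp [beforeCell, before, whole, moveHead]
    · by_cases h : i < x.length
      · simp [beforeCell, afterCell, before, whole, moveHead, h]; omega
      · simp [beforeCell, afterCell, before, whole, moveHead, h]; omega

theorem after_isPart (x y : List α) :
    (after y).IsPart (whole (x ++ y)) (afterCell x y)
      (beforeCell x y (Fin.last x.length)) where
  symbol_eq i := by
    obtain ⟨i, hi⟩ := i
    have h1 : x.length + 1 + i - 1 = x.length + i := by omega
    have h2 : (x ++ y)[x.length + i]? = y[i]? := by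
      rw [List.getElem?_append_right (by omega)]; congr 1; omega
    simp only [afterCell, tapeAt, h1, h2]
    cases y[i]? <;> simp
  move_eq d i := by
    obtain ⟨i, hi⟩ := i
    rcases d
    · simp [afterCell, after, whole, moveHead]
    · by_cases h : i = 0
      · simp [afterCell, beforeCell, after, whole, moveHead, h]
      · simp [afterCell, beforeCell, after, whole, moveHead, h]; omega
    · simp [afterCell, after, whole, moveHead]; omega

end TapeRegion

/-! ### Values of truncated runs, and comparison of a part of the tape with the whole. -/

namespace TwoQCFA

open Matrix

variable {α : Type*} (N : TwoQCFA α)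

/-- The value of a run of at most `t` steps that starts in the classical state `c` and the cell `i`
of the region `P`, as an observable of the initial register: when the run halts or leaves the region
in the classical state `c'`, the observable `G c'` is measured; a run that does neither is worth
`0`. This depends linearly on `G`. -/
noncomputable def runValue (P : TapeRegion α) :
    ℕ → N.C → P.Cell → (N.C → Matrix N.Q N.Q ℂ) →ₗ[ℂ] Matrix N.Q N.Q ℂ
  | 0, c, _ => if c ≠ N.cAcc ∧ c ≠ N.cRej then 0 else LinearMap.proj c
  | t + 1, c, i =>
    if hc : c ≠ N.cAcc ∧ c ≠ N.cRej then
      (N.θ ⟨c, hc⟩ (P.symbol i)).pullbackₗ fun r =>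
        (P.move (N.δ ⟨c, hc⟩ (P.symbol i) r).2 i).elim
          (LinearMap.proj (N.δ ⟨c, hc⟩ (P.symbol i) r).1)
          (runValue P t (N.δ ⟨c, hc⟩ (P.symbol i) r).1)
    else LinearMap.proj c

variable {N}

theorem runValue_of_halting (P : TapeRegion α) (G : N.C → Matrix N.Q N.Q ℂ) (t : ℕ) {c : N.C}
    (hc : ¬(c ≠ N.cAcc ∧ c ≠ N.cRej)) (i : P.Cell) : N.runValue P t c i G = G c := by
  cases t <;> simp only [runValue, hc] <;> simp

theorem runValue_zero (P : TapeRegion α) (G : N.C → Matrix N.Q N.Q ℂ) {c : N.C}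
    (hc : c ≠ N.cAcc ∧ c ≠ N.cRej) (i : P.Cell) : N.runValue P 0 c i G = 0 := by
  rw [runValue, if_pos hc, LinearMap.zero_apply]

theorem runValue_succ (P : TapeRegion α) (G : N.C → Matrix N.Q N.Q ℂ) (t : ℕ) {c : N.C}
    (hc : c ≠ N.cAcc ∧ c ≠ N.cRej) (i : P.Cell) :
    N.runValue P (t + 1) c i G = (N.θ ⟨c, hc⟩ (P.symbol i)).pullback fun r =>
      (P.move (N.δ ⟨c, hc⟩ (P.symbol i) r).2 i).elim (G (N.δ ⟨c, hc⟩ (P.symbol i) r).1)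
        fun j => N.runValue P t (N.δ ⟨c, hc⟩ (P.symbol i) r).1 j G := by
  rw [runValue, dif_pos hc, SelectiveOperation.pullbackₗ_apply]
  congr 1
  funext r
  cases P.move (N.δ ⟨c, hc⟩ (P.symbol i) r).2 i <;> rfl

/-- A run is an iterated pullback that ends in values of `G` or in `0`, so it never amplifies. This
is why errors only add up later on. -/
theorem formBound_runValue (P : TapeRegion α) {G : N.C → Matrix N.Q N.Q ℂ} {b : ℝ} (hb : 0 ≤ b)
    (hG : ∀ c, FormBound b (G c)) (t : ℕ) (c : N.C) (i : P.Cell) :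
    FormBound b (N.runValue P t c i G) := by
  induction t generalizing c i with
  | zero =>
    by_cases hc : c ≠ N.cAcc ∧ c ≠ N.cRej
    · rw [runValue_zero P G hc]
      exact formBound_zero.mono hb
    · rw [runValue_of_halting P G _ hc]
      exact hG c
  | succ t ih =>
    by_cases hc : c ≠ N.cAcc ∧ c ≠ N.cRej
    · rw [runValue_succ P G t hc]
      refine SelectiveOperation.formBound_pullback _ fun r => ?_
      cases P.move (N.δ ⟨c, hc⟩ (P.symbol i) r).2 i
      · exact hG _
      · exact ih _ _
    · rw [runValue_of_halting P G _ hc]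
      exact hG c

/-- An unfinished run is worth `0`; granting it one more step can only replace this by something
nonnegative. -/
theorem runValue_quadLE_succ (P : TapeRegion α) {G : N.C → Matrix N.Q N.Q ℂ}
    (hG : ∀ c, (0 : Matrix N.Q N.Q ℂ).QuadLE (G c)) (t : ℕ) (c : N.C) (i : P.Cell) :
    (N.runValue P t c i G).QuadLE (N.runValue P (t + 1) c i G) := by
  induction t generalizing c i with
  | zero =>
    by_cases hc : c ≠ N.cAcc ∧ c ≠ N.cRej
    · rw [runValue_zero P G hc, runValue_succ P G 0 hc]
      -- The value `0` is written as a pullback so that the two sides can be compared result by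
      -- result.
      have h0 : (0 : Matrix N.Q N.Q ℂ) = (N.θ ⟨c, hc⟩ (P.symbol i)).pullback fun _ => 0 := by
        simp [SelectiveOperation.pullback]
      conv_lhs => rw [h0]
      refine SelectiveOperation.pullback_quadLE _ fun r => ?_
      cases P.move (N.δ ⟨c, hc⟩ (P.symbol i) r).2 i with
      | none => exact hG _
      | some j =>
        by_cases hc' : (N.δ ⟨c, hc⟩ (P.symbol i) r).1 ≠ N.cAcc ∧
            (N.δ ⟨c, hc⟩ (P.symbol i) r).1 ≠ N.cRej
        · simp only [Option.elim, runValue_zero P G hc']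
          exact QuadLE.refl _
        · simp only [Option.elim, runValue_of_halting P G 0 hc']
          exact hG _
    · rw [runValue_of_halting P G _ hc, runValue_of_halting P G _ hc]
      exact QuadLE.refl _
  | succ t ih =>
    by_cases hc : c ≠ N.cAcc ∧ c ≠ N.cRej
    · rw [runValue_succ P G t hc, runValue_succ P G (t + 1) hc]
      refine SelectiveOperation.pullback_quadLE _ fun r => ?_
      cases P.move (N.δ ⟨c, hc⟩ (P.symbol i) r).2 i with
      | none => exact QuadLE.refl _
      | some j => exact ih _ _
    · rw [runValue_of_halting P G _ hc, runValue_of_halting P G _ hc]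
      exact QuadLE.refl _

theorem runValue_quadLE_of_le (P : TapeRegion α) {G : N.C → Matrix N.Q N.Q ℂ}
    (hG : ∀ c, (0 : Matrix N.Q N.Q ℂ).QuadLE (G c)) {s t : ℕ} (h : s ≤ t) (c : N.C) (i : P.Cell) :
    (N.runValue P s c i G).QuadLE (N.runValue P t c i G) := by
  induction t, h using Nat.le_induction with
  | base => exact QuadLE.refl _
  | succ t _ ih => exact ih.trans (runValue_quadLE_succ P hG t c i)

theorem zero_quadLE_runValue (P : TapeRegion α) {G : N.C → Matrix N.Q N.Q ℂ}
    (hG : ∀ c, (0 : Matrix N.Q N.Q ℂ).QuadLE (G c)) (t : ℕ) (c : N.C) (i : P.Cell) :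
    (0 : Matrix N.Q N.Q ℂ).QuadLE (N.runValue P t c i G) := by
  by_cases hc : c ≠ N.cAcc ∧ c ≠ N.cRej
  · rw [← runValue_zero P G hc i]
    exact runValue_quadLE_of_le P hG (Nat.zero_le t) c i
  · rw [runValue_of_halting P G _ hc]
    exact hG c

/-- If leaving a part of the tape is worth at most what `s` more steps on the whole are worth,
then `t` steps in the part are worth at most what `s + t` steps on the whole are worth. -/
theorem runValue_part_quadLE {P W : TapeRegion α} {e : P.Cell → W.Cell} {b : W.Cell}
    (hP : P.IsPart W e b) {G G₀ : N.C → Matrix N.Q N.Q ℂ}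
    (hG₀ : ∀ c, (0 : Matrix N.Q N.Q ℂ).QuadLE (G₀ c)) {s : ℕ}
    (hG : ∀ c, (G c).QuadLE (N.runValue W s c b G₀)) (t : ℕ) (c : N.C)
    (i : P.Cell) :
    (N.runValue P t c i G).QuadLE (N.runValue W (s + t) c (e i) G₀) := by
  have halt (t : ℕ) {c : N.C} (hc : ¬(c ≠ N.cAcc ∧ c ≠ N.cRej)) (i : P.Cell) :
      (N.runValue P t c i G).QuadLE (N.runValue W (s + t) c (e i) G₀) := by
    -- In a halting state the value on the whole tape does not depend on time or cell, so `hG`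
    -- already compares `G c` with `G₀ c`.
    rw [runValue_of_halting P G _ hc, runValue_of_halting _ G₀ _ hc,
      ← runValue_of_halting W G₀ s hc b]
    exact hG c
  induction t generalizing c i with
  | zero =>
    by_cases hc : c ≠ N.cAcc ∧ c ≠ N.cRej
    · rw [runValue_zero P G hc]
      exact zero_quadLE_runValue _ hG₀ _ _ _
    · exact halt 0 hc i
  | succ t ih =>
    by_cases hc : c ≠ N.cAcc ∧ c ≠ N.cRej
    · rw [runValue_succ P G t hc, ← add_assoc, runValue_succ W G₀ (s + t) hc]
      rw [hP.symbol_eq i]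
      refine SelectiveOperation.pullback_quadLE _ fun r => ?_
      simp only [hP.move_eq, Option.elim_some]
      cases P.move (N.δ ⟨c, hc⟩ (P.symbol i) r).2 i with
      | none => exact (hG _).trans (runValue_quadLE_of_le _ hG₀ (Nat.le_add_right s t) _ _)
      | some j => exact ih _ _
    · exact halt (t + 1) hc i

/-- If leaving a part of the tape is worth at least what `s` more steps on the whole are worth,
then `t ≤ s + 1` steps in the part are worth at least what they are worth on the whole. -/
theorem quadLE_runValue_part {P W : TapeRegion α} {e : P.Cell → W.Cell} {b : W.Cell}
    (hP : P.IsPart W e b) {G G₀ : N.C → Matrix N.Q N.Q ℂ}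
    (hG₀ : ∀ c, (0 : Matrix N.Q N.Q ℂ).QuadLE (G₀ c)) {s : ℕ}
    (hG : ∀ c, (N.runValue W s c b G₀).QuadLE (G c)) (t : ℕ) (ht : t ≤ s + 1)
    (c : N.C) (i : P.Cell) :
    (N.runValue W t c (e i) G₀).QuadLE (N.runValue P t c i G) := by
  have halt (t : ℕ) {c : N.C} (hc : ¬(c ≠ N.cAcc ∧ c ≠ N.cRej)) (i : P.Cell) :
      (N.runValue W t c (e i) G₀).QuadLE (N.runValue P t c i G) := by
    rw [runValue_of_halting P G _ hc, runValue_of_halting _ G₀ _ hc,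
      ← runValue_of_halting W G₀ s hc b]
    exact hG c
  induction t generalizing c i with
  | zero =>
    by_cases hc : c ≠ N.cAcc ∧ c ≠ N.cRej
    · rw [runValue_zero P G hc, runValue_zero _ G₀ hc]
      exact QuadLE.refl _
    · exact halt 0 hc i
  | succ t ih =>
    by_cases hc : c ≠ N.cAcc ∧ c ≠ N.cRej
    · rw [runValue_succ P G t hc, runValue_succ W G₀ t hc]
      rw [hP.symbol_eq i]
      refine SelectiveOperation.pullback_quadLE _ fun r => ?_
      simp only [hP.move_eq, Option.elim_some]
      cases P.move (N.δ ⟨c, hc⟩ (P.symbol i) r).2 i with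
      -- The step out of the part has been paid for: `t + 1 ≤ s + 1` leaves `t ≤ s` steps, which is
      -- where the bound on `t` is used.
      | none => exact (runValue_quadLE_of_le _ hG₀ (by omega) _ _).trans (hG _)
      | some j => exact ih (by omega) _ _
    · exact halt (t + 1) hc i

/-! ### Duality with ensembles -/

theorem sum_comm_two_three {M A B I J K : Type*} [AddCommMonoid M] [Fintype A] [Fintype B]
    [Fintype I] [Fintype J] [Fintype K] (f : A → B → I → J → K → M) :
    ∑ a, ∑ b, ∑ i, ∑ j, ∑ k, f a b i j k = ∑ i, ∑ j, ∑ k, ∑ a, ∑ b, f a b i j k := by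
  simpa only [Fintype.sum_prod_type] using
    Finset.sum_comm (s := Finset.univ) (t := Finset.univ)
      (f := fun (p : A × B) (q : I × J × K) => f p.1 p.2 q.1 q.2.1 q.2.2)

/-- Duality for a single step: `Y` is the pullback of the observable `X`, and on halted branches,
which do not change, the two agree. -/
theorem sum_trace_step_mul (w : List α) (Z : N.Ensemble w)
    {X Y : N.C → Fin (w.length + 2) → Matrix N.Q N.Q ℂ}
    (hX : ∀ c h, ¬(c ≠ N.cAcc ∧ c ≠ N.cRej) → X c h = Y c h)
    (hY : ∀ c h, (hc : c ≠ N.cAcc ∧ c ≠ N.cRej) →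
      Y c h = (N.θ ⟨c, hc⟩ (tapeAt w h)).pullback fun r =>
        X (N.δ ⟨c, hc⟩ (tapeAt w h) r).1 (moveHead (N.δ ⟨c, hc⟩ (tapeAt w h) r).2 h)) :
    ∑ c, ∑ h, (N.step w Z c h * X c h).trace = ∑ c, ∑ h, (Z c h * Y c h).trace := by
  have h1 : ∑ c', ∑ h', ((∑ c : N.NonHalting, ∑ h : Fin (w.length + 2), ∑ r : N.R,
      if (N.δ c (tapeAt w h) r).1 = c' ∧ moveHead (N.δ c (tapeAt w h) r).2 h = h' then
        (N.θ c (tapeAt w h)).branch r (Z c h)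
      else 0) * X c' h').trace = ∑ c : N.NonHalting, ∑ h, (Z c h * Y c h).trace := by
    simp only [Matrix.sum_mul, Matrix.trace_sum]
    have h2 (c : N.NonHalting) (h : Fin (w.length + 2)) (r : N.R) :
        ∑ c', ∑ h', ((if (N.δ c (tapeAt w h) r).1 = c' ∧
            moveHead (N.δ c (tapeAt w h) r).2 h = h' then
            (N.θ c (tapeAt w h)).branch r (Z c h) else 0) * X c' h').trace =
          ((N.θ c (tapeAt w h)).branch r (Z c h) * X (N.δ c (tapeAt w h) r).1
            (moveHead (N.δ c (tapeAt w h) r).2 h)).trace := by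
      rw [Finset.sum_eq_single_of_mem (N.δ c (tapeAt w h) r).1 (Finset.mem_univ _),
        Finset.sum_eq_single_of_mem (moveHead (N.δ c (tapeAt w h) r).2 h) (Finset.mem_univ _)]
      · simp
      · intro h' _ hne
        simp [hne.symm]
      · intro c' _ hne
        simp [hne.symm]
    calc _ = ∑ c : N.NonHalting, ∑ h, ∑ r, ∑ c', ∑ h', ((if (N.δ c (tapeAt w h) r).1 = c' ∧
            moveHead (N.δ c (tapeAt w h) r).2 h = h' then
            (N.θ c (tapeAt w h)).branch r (Z c h) else 0) * X c' h').trace := by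
          exact sum_comm_two_three _
      _ = _ := by
          simp only [h2]
          refine Finset.sum_congr rfl fun c _ => Finset.sum_congr rfl fun h _ => ?_
          rw [hY c h c.2, ← SelectiveOperation.sum_trace_branch_mul]
  have h3 : ∑ c, ∑ h, ((if c = N.cAcc ∨ c = N.cRej then Z c h else 0) * X c h).trace =
      ∑ c : {c : N.C // ¬(c ≠ N.cAcc ∧ c ≠ N.cRej)}, ∑ h, (Z c h * Y c h).trace := by
    rw [← Fintype.sum_subtype_add_sum_subtype (fun c => c ≠ N.cAcc ∧ c ≠ N.cRej)]
    rw [Finset.sum_eq_zero, zero_add]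
    · refine Finset.sum_congr rfl fun c _ => Finset.sum_congr rfl fun h _ => ?_
      rw [if_pos (by have := c.2; tauto), hX c h c.2]
    · rintro ⟨c, hc⟩ -
      refine Finset.sum_eq_zero fun h _ => ?_
      rw [if_neg (by tauto)]
      simp
  rw [← Fintype.sum_subtype_add_sum_subtype (fun c => c ≠ N.cAcc ∧ c ≠ N.cRej)
    (fun c => ∑ h, (Z c h * Y c h).trace), ← h1, ← h3]
  refine Eq.trans ?_ (add_comm _ _)
  rw [← Finset.sum_add_distrib]
  refine Finset.sum_congr rfl fun c _ => ?_
  rw [← Finset.sum_add_distrib]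
  refine Finset.sum_congr rfl fun h _ => ?_
  rw [step, Matrix.add_mul, Matrix.trace_add]

end TwoQCFA

/-! ### Perturbation of linear maps in terms of matrix units. -/

namespace Matrix

variable {Q : Type*} [Fintype Q]

theorem formBound_one [DecidableEq Q] : FormBound 1 (1 : Matrix Q Q ℂ) := fun u v => by
  rw [star_dotProduct_self_re, star_dotProduct_self_re, one_mul, one_mulVec,
    ← Finset.sum_add_distrib, Finset.sum_div]
  refine (norm_sum_le _ _).trans (Finset.sum_le_sum fun q _ => ?_)
  rw [norm_mul, Pi.star_apply, norm_star]
  nlinarith [sq_nonneg (‖u q‖ - ‖v q‖)]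

theorem QuadLE.apply_re_le [DecidableEq Q] {A B : Matrix Q Q ℂ} (h : A.QuadLE B) (q : Q) :
    (A q q).re ≤ (B q q).re := by
  simpa [mulVec_single, dotProduct, Pi.single_apply, apply_ite] using h (Pi.single q 1)

/-- Expand `G` in matrix units. Its coefficients have modulus at most 1, so each entry of the
difference is a sum of `|C| |Q|²` terms of size at most `δ`; passing from entries to the form costs
another factor `|Q|`. -/
theorem formBound_sub_of_basis [DecidableEq Q] {C : Type*} [Fintype C] [DecidableEq C] {δ : ℝ}
    {A A' : (C → Matrix Q Q ℂ) →ₗ[ℂ] Matrix Q Q ℂ}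
    (h : ∀ c q q' q₁ q₂, ‖A (Pi.single c (single q q' 1)) q₁ q₂ -
      A' (Pi.single c (single q q' 1)) q₁ q₂‖ ≤ δ)
    {G : C → Matrix Q Q ℂ} (hG : ∀ c, FormBound 1 (G c)) :
    FormBound (Fintype.card Q * (Fintype.card C * (Fintype.card Q * (Fintype.card Q * δ))))
      (A G - A' G) := by
  have hdec : G = ∑ c, ∑ q, ∑ q', G c q q' • Pi.single c (single q q' (1 : ℂ)) := by
    funext c
    simp only [Finset.sum_apply, Pi.smul_apply]
    rw [Finset.sum_eq_single_of_mem c (Finset.mem_univ _)]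
    · conv_lhs => rw [matrix_eq_sum_single (G c)]
      simp
    · intro c' _ hc'
      simp [Pi.single_eq_of_ne hc'.symm]
  refine formBound_of_norm_apply_le fun q₁ q₂ => ?_
  have h1 : (A G - A' G) q₁ q₂ = ∑ c, ∑ q, ∑ q', G c q q' *
      (A (Pi.single c (single q q' 1)) q₁ q₂ - A' (Pi.single c (single q q' 1)) q₁ q₂) := by
    conv_lhs => rw [hdec]
    simp only [map_sum, map_smul, sub_apply, sum_apply, smul_apply, smul_eq_mul, mul_sub,
      Finset.sum_sub_distrib]
  rw [h1]
  simp only [← nsmul_eq_mul, ← Finset.card_univ]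
  refine (norm_sum_le _ _).trans (Finset.sum_le_card_nsmul _ _ _ fun c _ => ?_)
  refine (norm_sum_le _ _).trans (Finset.sum_le_card_nsmul _ _ _ fun q _ => ?_)
  refine (norm_sum_le _ _).trans (Finset.sum_le_card_nsmul _ _ _ fun q' _ => ?_)
  rw [norm_mul]
  calc _ ≤ 1 * δ := mul_le_mul ((hG c).norm_apply_le q q') (h c q q' q₁ q₂) (norm_nonneg _)
        zero_le_one
    _ = δ := one_mul δ

end Matrix

/-! ### Halting probabilities as values of runs, and truncation of the running time. -/

namespace TwoQCFA

open Matrix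

variable {α : Type*} {N : TwoQCFA α}

/-- Steps are moved one by one from the ensemble to the observable, with `s` counting those already
moved. At `t = 0` the pure initial state selects one diagonal entry. -/
theorem sum_trace_ensembleAt_mul (w : List α) (s t : ℕ) (G : N.C → Matrix N.Q N.Q ℂ) :
    ∑ c, ∑ h, (N.ensembleAt w t c h * N.runValue (TapeRegion.whole w) s c h G).trace =
      N.runValue (TapeRegion.whole w) (s + t) N.cStart (0 : Fin (w.length + 2)) G
        N.qStart N.qStart := by
  induction t generalizing s with
  | zero =>
    rw [Finset.sum_eq_single_of_mem N.cStart (Finset.mem_univ _),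
      Finset.sum_eq_single_of_mem 0 (Finset.mem_univ _)]
    · simp [ensembleAt, initial, Matrix.trace_single_mul]
    · intro h _ hne
      simp [ensembleAt, initial, hne]
    · intro c _ hne
      simp [ensembleAt, initial, hne]
  | succ t ih =>
    rw [show s + (t + 1) = s + 1 + t by omega, ← ih (s + 1)]
    simp only [ensembleAt, Function.iterate_succ_apply']
    refine sum_trace_step_mul w _ (fun c h hc => ?_) (fun c h hc => ?_)
    · rw [runValue_of_halting _ _ _ hc, runValue_of_halting _ _ _ hc]
    · rw [runValue_succ _ _ _ hc]
      rfl

theorem stateProb_eq (w : List α) (t : ℕ) {c₀ : N.C} (hc₀ : ¬(c₀ ≠ N.cAcc ∧ c₀ ≠ N.cRej)) :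
    N.stateProb w t c₀ = (N.runValue (TapeRegion.whole w) t N.cStart (0 : Fin (w.length + 2))
      (Pi.single c₀ 1) N.qStart N.qStart).re := by
  have h := sum_trace_ensembleAt_mul (N := N) w 0 t (Pi.single c₀ 1)
  have h0 (c : N.C) (h : Fin (w.length + 2)) :
      N.runValue (TapeRegion.whole w) 0 c h (Pi.single c₀ 1) = (Pi.single c₀ 1 : N.C → Matrix N.Q N.Q ℂ) c := by
    by_cases hc : c ≠ N.cAcc ∧ c ≠ N.cRej
    · rw [runValue_zero _ _ hc, Pi.single_eq_of_ne]
      rintro rfl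
      exact hc₀ hc
    · rw [runValue_of_halting _ _ _ hc]
  simp only [h0, zero_add] at h
  rw [← h, Finset.sum_eq_single_of_mem c₀ (Finset.mem_univ _)]
  · simp [stateProb]
  · intro c _ hne
    simp [Pi.single_eq_of_ne hne]

theorem sum_stateProb (w : List α) (t : ℕ) : ∑ c, N.stateProb w t c = 1 := by
  have h : ∑ c, ∑ h, (N.ensembleAt w t c h).trace = 1 := by
    induction t with
    | zero =>
      rw [Finset.sum_eq_single_of_mem N.cStart (Finset.mem_univ _),
        Finset.sum_eq_single_of_mem 0 (Finset.mem_univ _)]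
      · simp [ensembleAt, initial]
      · intro h _ hne
        simp [ensembleAt, initial, hne]
      · intro c _ hne
        simp [ensembleAt, initial, hne]
    | succ t ih =>
      rw [← ih]
      simpa [ensembleAt, Function.iterate_succ_apply'] using
        sum_trace_step_mul w (N.ensembleAt w t) (X := fun _ _ => 1) (Y := fun _ _ => 1)
          (fun _ _ _ => rfl) (fun c h hc => (SelectiveOperation.pullback_one _).symm)
  simpa [stateProb, Complex.re_sum] using congrArg Complex.re h

theorem runsLongerProb_eq (w : List α) (t : ℕ) :
    N.runsLongerProb w t = 1 - N.stateProb w t N.cAcc - N.stateProb w t N.cRej := by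
  classical
  have h := sum_stateProb (N := N) w t
  have h1 : ∑ c : N.NonHalting, N.stateProb w t c =
      ∑ c ∈ (Finset.univ.erase N.cAcc).erase N.cRej, N.stateProb w t c :=
    (Finset.sum_subtype _ (by simp [and_comm]) _).symm
  rw [runsLongerProb, h1, ← h, ← Finset.add_sum_erase _ _ (Finset.mem_univ N.cAcc),
    ← Finset.add_sum_erase _ _ (Finset.mem_erase.2 ⟨N.acc_ne_rej.symm, Finset.mem_univ N.cRej⟩)]
  ring

theorem zero_quadLE_single_one (c₀ c : N.C) :
    (0 : Matrix N.Q N.Q ℂ).QuadLE ((Pi.single c₀ 1 : N.C → Matrix N.Q N.Q ℂ) c) := by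
  by_cases h : c = c₀
  · subst h
    simpa using quadLE_zero_one
  · simpa [Pi.single_eq_of_ne h] using QuadLE.refl _

theorem stateProb_mono (w : List α) {c₀ : N.C} (hc₀ : ¬(c₀ ≠ N.cAcc ∧ c₀ ≠ N.cRej)) :
    Monotone fun t => N.stateProb w t c₀ := fun s t hst => by
  simp only [stateProb_eq w _ hc₀]
  exact (runValue_quadLE_of_le _ (zero_quadLE_single_one c₀) hst _ _).apply_re_le _

theorem stateProb_nonneg (w : List α) (t : ℕ) {c₀ : N.C} (hc₀ : ¬(c₀ ≠ N.cAcc ∧ c₀ ≠ N.cRej)) :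
    0 ≤ N.stateProb w t c₀ := by
  simpa [stateProb_eq w t hc₀] using
    (zero_quadLE_runValue (TapeRegion.whole w) (zero_quadLE_single_one c₀) t N.cStart
      (0 : Fin (w.length + 2))).apply_re_le N.qStart

theorem not_nonHalting_cAcc : ¬(N.cAcc ≠ N.cAcc ∧ N.cAcc ≠ N.cRej) := fun h => h.1 rfl

theorem not_nonHalting_cRej : ¬(N.cRej ≠ N.cAcc ∧ N.cRej ≠ N.cRej) := fun h => h.2 rfl

/-- By linearity the sum is the value of a single family, equal to `1` at both halting states and
`0` elsewhere, which has form bound 1. -/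
theorem stateProb_acc_add_rej_le (w : List α) (t : ℕ) :
    N.stateProb w t N.cAcc + N.stateProb w t N.cRej ≤ 1 := by
  rw [stateProb_eq w t not_nonHalting_cAcc, stateProb_eq w t not_nonHalting_cRej,
    ← Complex.add_re, ← Matrix.add_apply, ← map_add]
  refine (Complex.re_le_norm _).trans ((formBound_runValue _ zero_le_one
    (fun c => ?_) _ _ _).norm_apply_le _ _)
  by_cases h : c = N.cAcc
  · subst h
    simpa [Pi.single_eq_of_ne N.acc_ne_rej] using formBound_one
  · by_cases h' : c = N.cRej
    · subst h'
      simpa [Pi.single_eq_of_ne N.acc_ne_rej.symm] using formBound_one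
    · simpa [Pi.single_eq_of_ne h, Pi.single_eq_of_ne h'] using formBound_zero.mono zero_le_one

theorem stateProb_le_one (w : List α) (t : ℕ) : N.stateProb w t N.cAcc ≤ 1 := by
  have := stateProb_acc_add_rej_le (N := N) w t
  have := stateProb_nonneg (N := N) w t not_nonHalting_cRej
  linarith

theorem stateProb_le_acceptProb (w : List α) (t : ℕ) : N.stateProb w t N.cAcc ≤ N.acceptProb w :=
  le_ciSup (f := fun t => N.stateProb w t N.cAcc)
    ⟨1, by rintro _ ⟨s, rfl⟩; exact stateProb_le_one w s⟩ t

/-- For each `s`, acceptance by time `s` and rejection by time `t` are both counted at time `max s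
t`. -/
theorem acceptProb_add_stateProb_rej_le (w : List α) (t : ℕ) :
    N.acceptProb w + N.stateProb w t N.cRej ≤ 1 := by
  have h : N.acceptProb w ≤ 1 - N.stateProb w t N.cRej := ciSup_le fun s => by
    have h1 := stateProb_acc_add_rej_le (N := N) w (max s t)
    have h2 := stateProb_mono (N := N) w not_nonHalting_cAcc (le_max_left s t)
    have h3 := stateProb_mono (N := N) w not_nonHalting_cRej (le_max_right s t)
    dsimp only at h2 h3
    linarith
  linarith

theorem runsLongerProb_anti (w : List α) : Antitone (N.runsLongerProb w) := fun s t hst => by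
  have h2 := stateProb_mono (N := N) w not_nonHalting_cAcc hst
  have h3 := stateProb_mono (N := N) w not_nonHalting_cRej hst
  dsimp only at h2 h3
  rw [runsLongerProb_eq, runsLongerProb_eq]
  linarith

/-- Markov's inequality: the first `t` terms of the series for the expected time are all at least
its term at `t`. -/
theorem mul_runsLongerProb_le {w : List α} {T : ℕ} (hT : N.expectedTime w ≤ T) (t : ℕ) :
    t * N.runsLongerProb w t ≤ T := by
  have h1 : (t : ENNReal) * ENNReal.ofReal (N.runsLongerProb w t) ≤ T := by
    refine le_trans ?_ ((ENNReal.sum_le_tsum (Finset.range t)).trans hT)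
    rw [← nsmul_eq_mul]
    refine le_trans (le_of_eq ?_) (Finset.card_nsmul_le_sum (Finset.range t) _
      (ENNReal.ofReal (N.runsLongerProb w t)) fun s hs => ENNReal.ofReal_le_ofReal
        (runsLongerProb_anti w (Finset.mem_range.1 hs).le))
    rw [Finset.card_range]
  rw [← ENNReal.ofReal_natCast t, ← ENNReal.ofReal_mul (Nat.cast_nonneg t),
    ENNReal.ofReal_le_iff_le_toReal (ENNReal.natCast_ne_top T)] at h1
  simpa using h1

/-- Acceptance after time `t` requires that the computation is still running at time `t`. -/
theorem acceptProb_sub_le_stateProb {w : List α} {T : ℕ} (hT : N.expectedTime w ≤ T) {t : ℕ}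
    (ht : 0 < t) : N.acceptProb w - T / t ≤ N.stateProb w t N.cAcc := by
  have h1 := acceptProb_add_stateProb_rej_le (N := N) w t
  have h2 := runsLongerProb_eq (N := N) w t
  have h3 : N.runsLongerProb w t ≤ T / t := by
    rw [le_div_iff₀ (by exact_mod_cast ht), mul_comm]
    exact mul_runsLongerProb_le hT t
  linarith

/-! ### Alternating between the two parts of a tape -/

/-- The values of `m` alternating runs of at most `t` steps each in two parts `P` and `S` of a tape,
when the halting classical states have the values `G`: the first component is for a start in the
cell `p` of `P`, the second one for a start in the cell `s` of `S`. -/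
noncomputable def roundValue (N : TwoQCFA α) (P S : TapeRegion α) (p : P.Cell) (s : S.Cell) (t : ℕ)
    (G : N.C → Matrix N.Q N.Q ℂ) :
    ℕ → (N.C → Matrix N.Q N.Q ℂ) × (N.C → Matrix N.Q N.Q ℂ)
  | 0 => (G, G)
  | m + 1 => (fun c => N.runValue P t c p (N.roundValue P S p s t G m).2,
      fun c => N.runValue S t c s (N.roundValue P S p s t G m).1)

theorem formBound_roundValue (P S : TapeRegion α) (p : P.Cell) (s : S.Cell) (t : ℕ)
    {G : N.C → Matrix N.Q N.Q ℂ} (hG : ∀ c, FormBound 1 (G c)) (m : ℕ) (c : N.C) :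
    FormBound 1 ((N.roundValue P S p s t G m).1 c) ∧
      FormBound 1 ((N.roundValue P S p s t G m).2 c) := by
  induction m generalizing c with
  | zero => exact ⟨hG c, hG c⟩
  | succ m ih =>
    exact ⟨formBound_runValue P zero_le_one (fun c => (ih c).2) _ _ _,
      formBound_runValue S zero_le_one (fun c => (ih c).1) _ _ _⟩

section Parts

variable {P S W : TapeRegion α} {eP : P.Cell → W.Cell} {eS : S.Cell → W.Cell} {p : P.Cell}
  {s : S.Cell} (hP : P.IsPart W eP (eS s)) (hS : S.IsPart W eS (eP p))
  {G : N.C → Matrix N.Q N.Q ℂ} (hG : ∀ c, (0 : Matrix N.Q N.Q ℂ).QuadLE (G c))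
  (hG' : ∀ c, c ≠ N.cAcc ∧ c ≠ N.cRej → G c = 0)

include hG'

theorem runValue_zero_eq (c : N.C) (i : W.Cell) : N.runValue W 0 c i G = G c := by
  by_cases hc : c ≠ N.cAcc ∧ c ≠ N.cRej
  · rw [runValue_zero _ _ hc, hG' c hc]
  · rw [runValue_of_halting _ _ _ hc]

include hP hS hG

/-- Each round takes at most `t` steps, so `m * t` steps on the whole tape cover `m` rounds. -/
theorem roundValue_quadLE (t m : ℕ) (c : N.C) :
    ((N.roundValue P S p s t G m).1 c).QuadLE (N.runValue W (m * t) c (eP p) G) ∧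
      ((N.roundValue P S p s t G m).2 c).QuadLE (N.runValue W (m * t) c (eS s) G) := by
  induction m generalizing c with
  | zero =>
    rw [zero_mul, runValue_zero_eq hG', runValue_zero_eq hG']
    exact ⟨QuadLE.refl _, QuadLE.refl _⟩
  | succ m ih =>
    rw [add_mul, one_mul]
    exact ⟨runValue_part_quadLE hP hG (fun c => (ih c).2) t c p,
      runValue_part_quadLE hS hG (fun c => (ih c).1) t c s⟩

/-- Each change of part uses a step, so `m` rounds are enough for `m` steps; `m ≤ t` ensures that no
round is cut short. -/
theorem quadLE_roundValue {t m : ℕ} (hm : m ≤ t) (c : N.C) :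
    (N.runValue W m c (eP p) G).QuadLE ((N.roundValue P S p s t G m).1 c) ∧
      (N.runValue W m c (eS s) G).QuadLE ((N.roundValue P S p s t G m).2 c) := by
  induction m generalizing c with
  | zero =>
    rw [runValue_zero_eq hG', runValue_zero_eq hG']
    exact ⟨QuadLE.refl _, QuadLE.refl _⟩
  | succ m ih =>
    have ih := ih (by omega)
    have h0 (c : N.C) : (0 : Matrix N.Q N.Q ℂ).QuadLE ((N.roundValue P S p s t G m).1 c) ∧
        (0 : Matrix N.Q N.Q ℂ).QuadLE ((N.roundValue P S p s t G m).2 c) :=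
      ⟨(zero_quadLE_runValue W hG m c _).trans (ih c).1,
        (zero_quadLE_runValue W hG m c _).trans (ih c).2⟩
    exact ⟨(quadLE_runValue_part hP hG (fun c => (ih c).2) _ le_rfl c p).trans
        (runValue_quadLE_of_le P (fun c => (h0 c).2) hm c p),
      (quadLE_runValue_part hS hG (fun c => (ih c).1) _ le_rfl c s).trans
        (runValue_quadLE_of_le S (fun c => (h0 c).1) hm c s)⟩

end Parts

end TwoQCFA

/-! ### Transfer entries of prefixes, their perturbation, and the counting bound. -/

namespace TwoQCFA

open Matrix

variable {α : Type*} {N : TwoQCFA α}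

/-- The probability that `N` accepts `x ++ y` in the course of `t + 1` alternating runs of at most
`t` steps each, the first one inside `#_L x`, the next one inside `y #_R`, and so on. -/
noncomputable def alternatingAcceptProb (N : TwoQCFA α) (x y : List α) (t : ℕ) : ℝ :=
  (N.runValue (TapeRegion.before x) t N.cStart (0 : Fin (x.length + 1))
    (N.roundValue (TapeRegion.before x) (TapeRegion.after y) (Fin.last x.length)
      (0 : Fin (y.length + 1)) t (Pi.single N.cAcc 1) t).2 N.qStart N.qStart).re

theorem single_cAcc_eq_zero (c : N.C) (hc : c ≠ N.cAcc ∧ c ≠ N.cRej) :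
    (Pi.single N.cAcc 1 : N.C → Matrix N.Q N.Q ℂ) c = 0 := Pi.single_eq_of_ne hc.1 _

theorem alternatingAcceptProb_le_acceptProb (x y : List α) (t : ℕ) :
    N.alternatingAcceptProb x y t ≤ N.acceptProb (x ++ y) := by
  have hP := TapeRegion.before_isPart x y
  have hS := TapeRegion.after_isPart x y
  have h1 := roundValue_quadLE (eP := TapeRegion.beforeCell x y) (eS := TapeRegion.afterCell x y)
    (p := Fin.last x.length) (s := (0 : Fin (y.length + 1))) hP hS (zero_quadLE_single_one N.cAcc) single_cAcc_eq_zero t t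
  have h := runValue_part_quadLE hP (zero_quadLE_single_one N.cAcc) (fun c => (h1 c).2)
    t N.cStart (0 : Fin (x.length + 1))
  refine (h.apply_re_le N.qStart).trans ?_
  refine le_trans (le_of_eq ?_) (stateProb_le_acceptProb (x ++ y) (t * t + t))
  exact (stateProb_eq (x ++ y) _ not_nonHalting_cAcc).symm

theorem stateProb_le_alternatingAcceptProb (x y : List α) (t : ℕ) :
    N.stateProb (x ++ y) t N.cAcc ≤ N.alternatingAcceptProb x y t := by
  have hP := TapeRegion.before_isPart x y
  have hS := TapeRegion.after_isPart x y
  have h1 := quadLE_roundValue (eP := TapeRegion.beforeCell x y) (eS := TapeRegion.afterCell x y)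
    (p := Fin.last x.length) (s := (0 : Fin (y.length + 1))) hP hS (zero_quadLE_single_one N.cAcc) single_cAcc_eq_zero
    (le_refl t)
  have h := quadLE_runValue_part hP (zero_quadLE_single_one N.cAcc) (fun c => (h1 c).2)
    t (Nat.le_succ t) N.cStart (0 : Fin (x.length + 1))
  refine le_trans (le_of_eq ?_) (h.apply_re_le N.qStart)
  exact stateProb_eq (x ++ y) _ not_nonHalting_cAcc

/-- The index set of the entries of the transfer matrices of prefixes. -/
abbrev TransferIndex (N : TwoQCFA α) : Type := Option N.C × N.C × N.Q × N.Q × N.Q × N.Q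

/-- The entries of the linear map that describes runs of at most `t` steps inside `#_L x`. They
start either initially or in the last cell. -/
noncomputable def transferEntry (N : TwoQCFA α) (x : List α) (t : ℕ) (I : N.TransferIndex) : ℂ :=
  (I.1.elim (N.runValue (TapeRegion.before x) t N.cStart (0 : Fin (x.length + 1)))
    fun c => N.runValue (TapeRegion.before x) t c (Fin.last x.length))
    (Pi.single I.2.1 (single I.2.2.1 I.2.2.2.1 1)) I.2.2.2.2.1 I.2.2.2.2.2

theorem formBound_single_single (c₀ c : N.C) (q q' : N.Q) :
    FormBound 1 ((Pi.single c₀ (single q q' 1) : N.C → Matrix N.Q N.Q ℂ) c) := by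
  by_cases h : c = c₀
  · subst h
    intro u v
    have h1 : star u ⬝ᵥ single q q' (1 : ℂ) *ᵥ v = star (u q) * v q' := by
      rw [single_mulVec, dotProduct, Finset.sum_eq_single_of_mem q (Finset.mem_univ _)]
      · simp
      · intro q'' _ hne
        simp [hne]
    rw [Pi.single_eq_same, h1, star_dotProduct_self_re, star_dotProduct_self_re, norm_mul,
      norm_star]
    have h2 := Finset.single_le_sum (f := fun q => ‖u q‖ ^ 2) (fun _ _ => by positivity)
      (Finset.mem_univ q)
    have h3 := Finset.single_le_sum (f := fun q => ‖v q‖ ^ 2) (fun _ _ => by positivity)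
      (Finset.mem_univ q')
    nlinarith [sq_nonneg (‖u q‖ - ‖v q'‖)]
  · rw [Pi.single_eq_of_ne h]
    exact formBound_zero.mono zero_le_one

theorem norm_transferEntry_le (x : List α) (t : ℕ) (I : N.TransferIndex) :
    ‖N.transferEntry x t I‖ ≤ 1 := by
  obtain ⟨o, c₀, q, q', q₁, q₂⟩ := I
  cases o <;>
  exact (formBound_runValue _ zero_le_one (fun c => formBound_single_single c₀ c q q')
    _ _ _).norm_apply_le q₁ q₂

/-- The factor by which differences of transfer entries are multiplied in each round. -/
def roundFactor (N : TwoQCFA α) : ℝ :=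
  Fintype.card N.Q * (Fintype.card N.C * (Fintype.card N.Q * Fintype.card N.Q))

theorem roundFactor_nonneg : 0 ≤ N.roundFactor := by
  unfold roundFactor
  positivity

section Close

variable {x x' : List α} {t : ℕ} {δ : ℝ}
  (h : ∀ I, ‖N.transferEntry x t I - N.transferEntry x' t I‖ ≤ δ)

include h

theorem formBound_runValue_last_sub {G : N.C → Matrix N.Q N.Q ℂ} (hG : ∀ c, FormBound 1 (G c))
    (c : N.C) : FormBound (N.roundFactor * δ)
      (N.runValue (TapeRegion.before x) t c (Fin.last x.length) G -
        N.runValue (TapeRegion.before x') t c (Fin.last x'.length) G) := by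
  refine (formBound_sub_of_basis (fun c₀ q q' q₁ q₂ => h (some c, c₀, q, q', q₁, q₂)) hG).mono
    (le_of_eq ?_)
  unfold roundFactor
  ring

theorem formBound_runValue_start_sub {G : N.C → Matrix N.Q N.Q ℂ} (hG : ∀ c, FormBound 1 (G c)) :
    FormBound (N.roundFactor * δ)
      (N.runValue (TapeRegion.before x) t N.cStart (0 : Fin (x.length + 1)) G -
        N.runValue (TapeRegion.before x') t N.cStart (0 : Fin (x'.length + 1)) G) := by
  refine (formBound_sub_of_basis (fun c₀ q q' q₁ q₂ => h (none, c₀, q, q', q₁, q₂)) hG).mono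
    (le_of_eq ?_)
  unfold roundFactor
  ring

/-- Every run in the prefix contributes at most `roundFactor * δ`, and neither prefix nor suffix
runs amplify earlier errors, so the bound grows linearly in `m`. -/
theorem formBound_roundValue_sub (hδ : 0 ≤ δ) (S : TapeRegion α) (s : S.Cell)
    {G : N.C → Matrix N.Q N.Q ℂ} (hG : ∀ c, FormBound 1 (G c)) (m : ℕ) (c : N.C) :
    FormBound (m * (N.roundFactor * δ))
      ((N.roundValue (TapeRegion.before x) S (Fin.last x.length) s t G m).1 c -
        (N.roundValue (TapeRegion.before x') S (Fin.last x'.length) s t G m).1 c) ∧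
    FormBound (m * (N.roundFactor * δ))
      ((N.roundValue (TapeRegion.before x) S (Fin.last x.length) s t G m).2 c -
        (N.roundValue (TapeRegion.before x') S (Fin.last x'.length) s t G m).2 c) := by
  have hr : 0 ≤ N.roundFactor * δ := mul_nonneg roundFactor_nonneg hδ
  induction m generalizing c with
  | zero => simpa [roundValue] using formBound_zero
  | succ m ih =>
    have hm : 0 ≤ m * (N.roundFactor * δ) := mul_nonneg (Nat.cast_nonneg m) hr
    constructor
    -- With `A`, `A'` the two prefix maps: `A G - A' G' = A (G - G') + (A - A') G'`. The first term
    -- carries the old error, the second adds one new error.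
    · have h1 := formBound_runValue (TapeRegion.before x) hm (fun c => (ih c).2) t c
        (Fin.last x.length)
      have h2 := formBound_runValue_last_sub h (fun c => (formBound_roundValue
        (TapeRegion.before x') S (Fin.last x'.length) s t hG m c).2) c
      have h3 := (h1.add h2).mono (b := (m + 1 : ℕ) * (N.roundFactor * δ)) (by push_cast; linarith)
      refine cast (congrArg _ ?_) h3
      change N.runValue _ _ _ _ (_ - _) + _ = _
      rw [map_sub, sub_add_sub_cancel]
      rfl
    -- The suffix map is the same on both sides and adds no error.
    · have h1 := (formBound_runValue S hm (fun c => (ih c).1) t c s).mono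
        (b := (m + 1 : ℕ) * (N.roundFactor * δ)) (by push_cast; linarith)
      refine cast (congrArg _ ?_) h1
      change N.runValue _ _ _ _ (_ - _) = _
      rw [map_sub]
      rfl

theorem abs_alternatingAcceptProb_sub_le (hδ : 0 ≤ δ) (y : List α) :
    |N.alternatingAcceptProb x y t - N.alternatingAcceptProb x' y t| ≤
      (t + 1) * (N.roundFactor * δ) := by
  have hG (c : N.C) : FormBound 1 ((Pi.single N.cAcc 1 : N.C → Matrix N.Q N.Q ℂ) c) := by
    by_cases h : c = N.cAcc
    · subst h
      simpa using formBound_one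
    · simpa [Pi.single_eq_of_ne h] using formBound_zero.mono zero_le_one
  have hm : 0 ≤ t * (N.roundFactor * δ) :=
    mul_nonneg (Nat.cast_nonneg t) (mul_nonneg roundFactor_nonneg hδ)
  have h1 := formBound_runValue (TapeRegion.before x) hm (fun c =>
    (formBound_roundValue_sub h hδ (TapeRegion.after y) (0 : Fin (y.length + 1)) hG t c).2) t
    N.cStart (0 : Fin (x.length + 1))
  have h2 := formBound_runValue_start_sub h (fun c => (formBound_roundValue
    (TapeRegion.before x') (TapeRegion.after y) (Fin.last x'.length) (0 : Fin (y.length + 1)) t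
    hG t c).2)
  have h3 := (h1.add h2).norm_apply_le N.qStart N.qStart
  rw [alternatingAcceptProb, alternatingAcceptProb, ← Complex.sub_re, ← Matrix.sub_apply]
  refine (Complex.abs_re_le_norm _).trans (le_trans (le_of_eq ?_) (h3.trans (by linarith)))
  refine congrArg (fun A : Matrix N.Q N.Q ℂ => ‖A N.qStart N.qStart‖) ?_
  refine Eq.symm ?_
  change N.runValue _ _ _ _ (_ - _) + _ = _
  rw [map_sub, sub_add_sub_cancel]

end Close

/-- Prefixes with nearly equal transfer entries are not told apart by any suffix. -/
theorem Recognizes.mem_of_mem_of_close {L : Language α} {ε : ℝ} (hN : N.Recognizes L ε)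
    {x x' y : List α} {T t : ℕ} {δ : ℝ} (hT : N.expectedTime (x ++ y) ≤ T) (ht : 0 < t)
    (hδ : 0 ≤ δ) (h : ∀ I, ‖N.transferEntry x t I - N.transferEntry x' t I‖ ≤ δ)
    (hb : T / t + (t + 1) * (N.roundFactor * δ) < 1 - 2 * ε) (hx : x ++ y ∈ L) : x' ++ y ∈ L := by
  by_contra hx'
  have h1 := hN.1 _ hx
  have h2 := hN.2 _ hx'
  -- Truncation is applied only to `x ++ y`; for `x' ++ y` the upper half of the sandwich holds for
  -- the untruncated probability, so no time bound is needed there.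
  have h3 := acceptProb_sub_le_stateProb hT ht
  have h4 := stateProb_le_alternatingAcceptProb (N := N) x y t
  have h5 := alternatingAcceptProb_le_acceptProb (N := N) x' y t
  have h6 := (abs_le.1 (abs_alternatingAcceptProb_sub_le h hδ y)).2
  linarith

/-- Pigeonhole: real and imaginary parts of the entries are rounded down to multiples of `1 / W`,
with `2 * W + 1` possible values each. Equal roundings give entries at distance at most `2 / W`. -/
theorem card_le_of_pairwise_dissimilar {L : Language α} {ε : ℝ} (hN : N.Recognizes L ε)
    {n T t W : ℕ} (hT : ∀ w : List α, w.length ≤ n → N.expectedTime w ≤ T) (ht : 0 < t)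
    (hW : 0 < W) (hb : (T : ℝ) / t + (t + 1) * (N.roundFactor * (2 / W)) < 1 - 2 * ε) {k : ℕ}
    {x : Fin k → List α} (hx : ∀ i j, i ≠ j → Dissimilar L n (x i) (x j)) :
    k ≤ ((2 * W + 1) * (2 * W + 1)) ^ Fintype.card N.TransferIndex := by
  have hW' : (0 : ℝ) < W := by exact_mod_cast hW
  let f : Fin k → N.TransferIndex → ℤ × ℤ := fun i I =>
    (⌊(N.transferEntry (x i) t I).re * W⌋, ⌊(N.transferEntry (x i) t I).im * W⌋)
  let box : Finset (N.TransferIndex → ℤ × ℤ) :=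
    Fintype.piFinset fun _ => Finset.Icc (-(W : ℤ)) W ×ˢ Finset.Icc (-(W : ℤ)) W
  have hmem (i : Fin k) : f i ∈ box := by
    have key (a : ℝ) (ha : |a| ≤ 1) : ⌊a * W⌋ ∈ Finset.Icc (-(W : ℤ)) W := by
      rw [abs_le] at ha
      rw [Finset.mem_Icc, Int.le_floor, Int.floor_le_iff]
      push_cast
      constructor <;> nlinarith
    refine Fintype.mem_piFinset.2 fun I => Finset.mem_product.2 ⟨key _ ?_, key _ ?_⟩
    · exact (Complex.abs_re_le_norm _).trans (norm_transferEntry_le _ _ _)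
    · exact (Complex.abs_im_le_norm _).trans (norm_transferEntry_le _ _ _)
  have hinj : Function.Injective f := fun i j hij => by
    by_contra hne
    have hclose (I : N.TransferIndex) :
        ‖N.transferEntry (x i) t I - N.transferEntry (x j) t I‖ ≤ 2 / W := by
      have hI := congrFun hij I
      have key {a b : ℝ} (hab : ⌊a * W⌋ = ⌊b * W⌋) : |a - b| ≤ 1 / W := by
        have h1 := (Int.abs_sub_lt_one_of_floor_eq_floor hab).le
        rwa [← sub_mul, abs_mul, abs_of_pos hW', ← le_div_iff₀ hW'] at h1
      refine (Complex.norm_le_abs_re_add_abs_im _).trans ?_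
      rw [Complex.sub_re, Complex.sub_im, show (2 : ℝ) / W = 1 / W + 1 / W by ring]
      exact add_le_add (key (congrArg Prod.fst hI)) (key (congrArg Prod.snd hI))
    obtain ⟨y, hy, hiff⟩ := hx i j hne
    have hi : (x i ++ y).length ≤ n := by
      rw [List.length_append]; exact (Nat.add_le_add_right (le_max_left _ _) _).trans hy
    have hj : (x j ++ y).length ≤ n := by
      rw [List.length_append]; exact (Nat.add_le_add_right (le_max_right _ _) _).trans hy
    have h1 := hN.mem_of_mem_of_close (y := y) (hT _ hi) ht (by positivity) hclose hb
    have h2 := hN.mem_of_mem_of_close (y := y) (hT _ hj) ht (by positivity)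
      (fun I => norm_sub_rev (N.transferEntry (x i) t I) _ ▸ hclose I) hb
    tauto
  have hcard := Finset.card_le_card_of_injOn f (s := Finset.univ) (t := box)
    (fun i _ => hmem i) hinj.injOn
  have hbox : box.card = ((2 * W + 1) * (2 * W + 1)) ^ Fintype.card N.TransferIndex := by
    change (Fintype.piFinset fun _ => Finset.Icc (-(W : ℤ)) W ×ˢ Finset.Icc (-(W : ℤ)) W).card = _
    rw [Fintype.card_piFinset, Finset.prod_const, Finset.card_univ, Finset.card_product, Int.card_Icc]
    congr 2 <;> omega
  simpa [hbox] using hcard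

end TwoQCFA

/-! ### Interpreting advice as a straight-line program -/

/-- The control states of the interpreter: `ready` to change the store, `failed` a comparison, `done`
with the current input symbol, or `accepted`. -/
inductive ControlFlag where
  | ready | failed | done | accepted
  deriving DecidableEq

instance : Fintype ControlFlag :=
  ⟨{.ready, .failed, .done, .accepted}, fun f => by cases f <;> simp⟩

/-- The instructions of a straight-line program with access to an input tape and a bit tape. -/
inductive Instr (α : Type*) where
  | compare (b : Bool)
  | letter (a : α)
  | left
  | write (b : Bool)
  | advance
  | reset
  | accept

namespace Instr

variable {α : Type*}

/-- The move of the work head. -/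
def move : Instr α → SignType
  | compare _ => .pos
  | left => .neg
  | _ => .zero

open Classical in
/-- The effect of an instruction on the flag, the scanned bit, and the input head. -/
noncomputable def exec : Instr α → ControlFlag → TapeSymbol α → Bool → ControlFlag × Bool × SignType
  | compare b, f, _, g => (if f = .ready ∧ g ≠ b then .failed else f, g, .zero)
  | letter a, f, σ, g => (if f = .ready ∧ σ ≠ .symbol a then .failed else f, g, .zero)
  | left, f, _, g => (f, g, .zero)
  | write b, f, _, g => (f, if f = .ready then b else g, .zero)
  -- The flag `done` disables the remaining transitions of the same simulated step, which could
  -- otherwise fire on the new state and symbol.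
  | advance, .ready, _, g => (.done, g, .pos)
  | advance, .failed, _, g => (.ready, g, .zero)
  | advance, f, _, g => (f, g, .zero)
  | reset, f, _, g => (if f = .accepted then f else .ready, g, .zero)
  | accept, f, _, g => (if f = .ready then .accepted else f, g, .zero)

theorem finite [Finite α] : Finite (Instr α) := by
  refine Finite.of_injective (β := (Bool ⊕ Bool) ⊕ α ⊕ Fin 4) (fun
    | compare b => .inl (.inl b)
    | write b => .inl (.inr b)
    | letter a => .inr (.inl a)
    | left => .inr (.inr 0)
    | advance => .inr (.inr 1)
    | reset => .inr (.inr 2)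
    | accept => .inr (.inr 3)) fun i j h => ?_
  cases i <;> cases j <;> simp_all

/-- The contents of the tapes and the positions of the heads, apart from those that concern the
program. -/
@[ext]
structure Store (w : List α) where
  flag : ControlFlag
  pos : Fin (w.length + 2)
  head : ℕ
  work : ℕ → Bool

/-- The effect of an instruction on the store. -/
noncomputable def run {w : List α} (s : Store w) (I : Instr α) : Store w where
  flag := (I.exec s.flag (tapeAt w s.pos) (s.work s.head)).1
  pos := moveHead (I.exec s.flag (tapeAt w s.pos) (s.work s.head)).2.2 s.pos
  head := AdviceTM.moveWork I.move s.head
  work := Function.update s.work s.head (I.exec s.flag (tapeAt w s.pos) (s.work s.head)).2.1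

/-- The work head, starting in cell `j`, does not leave the cells `0, …, k`. -/
def StaysBelow (k : ℕ) : List (Instr α) → ℕ → Prop
  | [], j => j ≤ k
  | I :: l, j => j ≤ k ∧ StaysBelow k l (AdviceTM.moveWork I.move j)

theorem StaysBelow.append {k j j' : ℕ} {l l' : List (Instr α)} (h : StaysBelow k l j)
    (hj : l.foldl (fun j I => AdviceTM.moveWork I.move j) j = j') (h' : StaysBelow k l' j') :
    StaysBelow k (l ++ l') j := by
  induction l generalizing j with
  | nil =>
    subst hj
    exact h'
  | cons I l ih => exact ⟨h.1, ih h.2 hj⟩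

theorem StaysBelow.head_foldl_le {k : ℕ} {prog : List (Instr α)} {w : List α} {s : Store w}
    (h : StaysBelow k prog s.head) : (prog.foldl run s).head ≤ k := by
  induction prog generalizing s with
  | nil => exact h
  | cons I prog ih => exact ih h.2

end Instr

/-! ### The interpreter as a Turing machine with advice -/

namespace Interpreter

open Instr

variable {α : Type*} [Fintype α]

noncomputable instance : Fintype (Instr α) :=
  have := Instr.finite (α := α)
  Fintype.ofFinite _

/-- The code of an instruction. -/
noncomputable def index (I : Instr α) : Fin (Fintype.card (Instr α) + 1) :=
  (Fintype.equivFin (Instr α) I).castSucc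

/-- The instruction with a given code. -/
noncomputable def decode (i : Fin (Fintype.card (Instr α) + 1)) : Instr α :=
  have : Nonempty (Instr α) := ⟨Instr.left⟩
  Function.invFun index i

theorem decode_index (I : Instr α) : decode (index I) = I := by
  have : Nonempty (Instr α) := ⟨Instr.left⟩
  exact Function.leftInverse_invFun
    ((Fin.castSucc_injective _).comp (Fintype.equivFin (Instr α)).injective) I

/-- Instructions are written in unary. -/
noncomputable def bits (I : Instr α) : List Bool := List.replicate (index I) true ++ [false]

theorem length_bits_le (I : Instr α) : (bits I).length ≤ Fintype.card (Instr α) + 1 := by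
  simp only [bits, List.length_append, List.length_replicate, List.length_singleton]
  have := (Fintype.equivFin (Instr α) I).isLt
  simp only [index, Fin.val_castSucc]
  omega

/-- The Turing machine that reads its advice from left to right and executes it. -/
noncomputable def machine (α : Type*) [Fintype α] : AdviceTM α where
  State := Bool ⊕ (ControlFlag × Fin (Fintype.card (Instr α) + 1))
  Γ := Bool
  blank := false
  start := .inr (.ready, 0)
  acc := .inl true
  rej := .inl false
  acc_ne_rej := by simp
  trans q σ τ g :=
    match q, τ with
    | .inl b, _ => (.inl b, g, .zero, .zero, .zero)
    | .inr q, .leftEnd => (.inr q, g, .zero, .pos, .zero)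
    | .inr (f, _), .rightEnd => (.inl (f = .accepted), g, .zero, .zero, .zero)
    | .inr (f, i), .symbol true => (.inr (f, i + 1), g, .zero, .pos, .zero)
    | .inr (f, i), .symbol false =>
      (.inr (((decode i).exec f σ g).1, 0), ((decode i).exec f σ g).2.1,
        ((decode i).exec f σ g).2.2, .pos, (decode (α := α) i).move)

variable {w : List α} {y : List Bool}

/-- The configuration with a given store, a given value of the instruction counter, and a given
position of the advice head. -/
def conf (y : List Bool) (s : Store w) (i : Fin (Fintype.card (Instr α) + 1))
    (p : Fin (y.length + 2)) : (machine α).Config w y where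
  state := .inr (s.flag, i)
  inputHead := s.pos
  adviceHead := p
  workHead := s.head
  work := s.work

/-- The rest of the advice, with the advice head in position `p`, is `l`. -/
def Rest (y : List Bool) (p : Fin (y.length + 2)) (l : List Bool) : Prop :=
  0 < (p : ℕ) ∧ y.drop (p - 1) = l

theorem Rest.tapeAt_eq {p : Fin (y.length + 2)} {b : Bool} {l : List Bool}
    (h : Rest y p (b :: l)) : tapeAt y p = .symbol b := by
  have h1 : y[(p : ℕ) - 1]? = some b := by
    rw [← Nat.add_zero ((p : ℕ) - 1), ← List.getElem?_drop, h.2]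
    rfl
  rw [tapeAt, if_neg h.1.ne', h1]

theorem Rest.tapeAt_eq_rightEnd {p : Fin (y.length + 2)} (h : Rest y p []) :
    tapeAt y p = .rightEnd := by
  have h1 : y[(p : ℕ) - 1]? = none := by
    rw [← Nat.add_zero ((p : ℕ) - 1), ← List.getElem?_drop, h.2]
    rfl
  rw [tapeAt, if_neg h.1.ne', h1]

theorem Rest.eq_last {p : Fin (y.length + 2)} (h : Rest y p []) : p = Fin.last _ := by
  have h1 := List.drop_eq_nil_iff.1 h.2
  have h2 := h.1
  have h3 := p.isLt
  exact Fin.ext (by rw [Fin.val_last]; omega)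

theorem Rest.tail {p : Fin (y.length + 2)} {b : Bool} {l : List Bool}
    (h : Rest y p (b :: l)) : Rest y (moveHead .pos p) l := by
  have h0 := h.1
  have h1 : (p : ℕ) - 1 < y.length := by
    by_contra hp
    have := h.2
    rw [List.drop_eq_nil_of_le (by omega)] at this
    simp at this
  have h2 : ((moveHead .pos p : Fin (y.length + 2)) : ℕ) = p + 1 := by
    simp only [moveHead]
    omega
  refine ⟨by omega, ?_⟩
  rw [h2, show (p : ℕ) + 1 - 1 = (p - 1) + 1 by omega, ← List.drop_drop, h.2]
  rfl

theorem step_conf_true {s : Store w} {i : Fin (Fintype.card (Instr α) + 1)}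
    {p : Fin (y.length + 2)} (h : tapeAt y p = .symbol true) :
    (machine α).step w y (conf y s i p) = conf y s (i + 1) (moveHead .pos p) := by
  simp [AdviceTM.step, machine, conf, h, moveHead, AdviceTM.moveWork]

theorem step_conf_false {s : Store w} {i : Fin (Fintype.card (Instr α) + 1)}
    {p : Fin (y.length + 2)} (h : tapeAt y p = .symbol false) :
    (machine α).step w y (conf y s i p) = conf y (run s (decode i)) 0 (moveHead .pos p) := by
  simp [AdviceTM.step, machine, conf, h, run]

/-- Some number of steps lead from `K` to `K'`, with the work head always in the cells
`0, …, k`. -/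
def Reach (k : ℕ) (K K' : (machine α).Config w y) : Prop :=
  ∃ t, ((machine α).step w y)^[t] K = K' ∧
    ∀ u ≤ t, (((machine α).step w y)^[u] K).workHead ≤ k

theorem Reach.refl {k : ℕ} {K : (machine α).Config w y} (h : K.workHead ≤ k) : Reach k K K :=
  ⟨0, rfl, fun u hu => by obtain rfl := Nat.le_zero.1 hu; exact h⟩

theorem Reach.head {k : ℕ} {K K' : (machine α).Config w y} (h : K.workHead ≤ k)
    (hK : Reach k ((machine α).step w y K) K') : Reach k K K' := by
  obtain ⟨t, ht, hu⟩ := hK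
  refine ⟨t + 1, ht, fun u hut => ?_⟩
  cases u with
  | zero => exact h
  | succ u => exact hu u (by omega)

/-- The counter in the finite control counts the ones of the unary code, and the closing zero
triggers execution. The continuation `hK` is quantified over advice positions, which thus need not
be computed. -/
theorem reach_instr {k : ℕ} (I : Instr α) (prog : List (Instr α)) {s : Store w}
    {p : Fin (y.length + 2)} {K : (machine α).Config w y} (hs : s.head ≤ k)
    (hp : Rest y p (bits I ++ prog.flatMap bits))
    (hK : ∀ p, Rest y p (prog.flatMap bits) → Reach k (conf y (run s I) 0 p) K) :
    Reach k (conf y s 0 p) K := by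
  have key (m : ℕ) (i : Fin (Fintype.card (Instr α) + 1)) (p : Fin (y.length + 2))
      (hp : Rest y p (List.replicate m true ++ false :: prog.flatMap bits))
      (hi : (i : ℕ) + m = index I) :
      Reach k (conf y s i p) K := by
    induction m generalizing i p with
    | zero =>
      refine Reach.head hs ?_
      rw [step_conf_false hp.tapeAt_eq]
      have : i = index I := Fin.ext hi
      rw [this, decode_index]
      exact hK _ hp.tail
    | succ m ih =>
      refine Reach.head hs ?_
      rw [List.replicate_succ, List.cons_append] at hp
      rw [step_conf_true hp.tapeAt_eq]
      refine ih _ _ hp.tail ?_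
      have := (index I).isLt
      rw [Fin.val_add_one_of_lt (by rw [Fin.lt_def, Fin.val_last]; omega)]
      omega
  refine key (index I) 0 p (by simpa [bits] using hp) ?_
  simp

theorem reach_program {k : ℕ} (prog : List (Instr α)) {s : Store w} {p : Fin (y.length + 2)}
    {K : (machine α).Config w y} (hs : StaysBelow k prog s.head)
    (hp : Rest y p (prog.flatMap bits))
    (hK : ∀ p, Rest y p [] → Reach k (conf y (prog.foldl run s) 0 p) K) :
    Reach k (conf y s 0 p) K := by
  induction prog generalizing s p with
  | nil => exact hK p hp
  | cons I prog ih =>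
    exact reach_instr I prog hs.1 hp fun q hq => ih hs.2 hq hK

/-- Once a fixed point is reached nothing moves, so the bound along the path holds for all times. -/
theorem Reach.workHead_le {k : ℕ} {K K' : (machine α).Config w y} (h : Reach k K K')
    (hK' : (machine α).step w y K' = K') (t : ℕ) :
    (((machine α).step w y)^[t] K).workHead ≤ k := by
  obtain ⟨t₀, ht₀, hu⟩ := h
  rcases le_total t t₀ with htt | htt
  · exact hu t htt
  · obtain ⟨d, rfl⟩ := Nat.exists_eq_add_of_le' htt
    rw [Function.iterate_add_apply, ht₀, Function.iterate_fixed hK', ← ht₀]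
    exact hu t₀ le_rfl

/-- The store at the beginning of a computation. -/
def initialStore (w : List α) : Store w where
  flag := .ready
  pos := 0
  head := 0
  work := fun _ => false

theorem step_initial :
    (machine α).step w y ((machine α).initial w y) =
      conf y (initialStore w) 0 (moveHead .pos 0) := by
  simp [AdviceTM.step, AdviceTM.initial, machine, conf, initialStore, tapeAt, moveHead,
    AdviceTM.moveWork]

theorem step_conf_rightEnd {s : Store w} {i : Fin (Fintype.card (Instr α) + 1)}
    {p : Fin (y.length + 2)} (h : tapeAt y p = .rightEnd) :
    (machine α).step w y (conf y s i p) =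
      ⟨.inl (s.flag = .accepted), s.pos, p, s.head, s.work⟩ := by
  simp [AdviceTM.step, machine, conf, h, moveHead, AdviceTM.moveWork]

/-- The machine executes a program that is given to it as advice. -/
theorem machine_spec {k : ℕ} {prog : List (Instr α)} (hs : StaysBelow k prog 0) (w : List α) :
    (machine α).UsesSpaceAtMost w (prog.flatMap bits) (k + 1) ∧
      ((prog.foldl run (initialStore w)).flag = .accepted →
        (machine α).Accepts w (prog.flatMap bits)) ∧
      ((prog.foldl run (initialStore w)).flag ≠ .accepted →
        (machine α).Rejects w (prog.flatMap bits)) := by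
  obtain ⟨K, hK, hstate⟩ : ∃ K : (machine α).Config w (prog.flatMap bits),
      Reach k ((machine α).initial w (prog.flatMap bits)) K ∧
      K.state = .inl (decide ((prog.foldl run (initialStore w)).flag = .accepted)) := by
    refine ⟨⟨.inl (decide ((prog.foldl run (initialStore w)).flag = .accepted)),
      (prog.foldl run (initialStore w)).pos, Fin.last _, (prog.foldl run (initialStore w)).head,
      (prog.foldl run (initialStore w)).work⟩, Reach.head (Nat.zero_le k) ?_, rfl⟩
    -- The first step only moves the advice head off its left end-marker.
    rw [step_initial]
    refine reach_program prog hs ⟨?_, ?_⟩ fun p hp => ?_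
    · simp [moveHead]
    · simp [moveHead]
    · have hle : (prog.foldl run (initialStore w)).head ≤ k := StaysBelow.head_foldl_le hs
      refine Reach.head hle ?_
      rw [step_conf_rightEnd hp.tapeAt_eq_rightEnd, hp.eq_last]
      exact Reach.refl hle
  have hfix : (machine α).step w (prog.flatMap bits) K = K := by
    rw [AdviceTM.step, if_pos]
    rw [hstate]
    cases decide ((prog.foldl run (initialStore w)).flag = .accepted)
    · exact Or.inr rfl
    · exact Or.inl rfl
  refine ⟨fun t => Nat.lt_succ_of_le (hK.workHead_le hfix t), fun h => ?_, fun h => ?_⟩ <;>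
  · obtain ⟨t, ht, -⟩ := hK
    refine ⟨t, ?_⟩
    rw [AdviceTM.configAt, ht, hstate]
    simp [h, machine]

end Interpreter

/-! ### A program that simulates a finite automaton -/

namespace Instr

variable {α : Type*} {w : List α}

/-- The cells `j, j + 1, …` hold the bits of `l`. -/
def Holds (g : ℕ → Bool) : ℕ → List Bool → Prop
  | _, [] => True
  | j, b :: l => g j = b ∧ Holds g (j + 1) l

theorem Holds.eq_of_length_eq {g : ℕ → Bool} {j : ℕ} {l l' : List Bool} (h : Holds g j l)
    (h' : Holds g j l') (hl : l.length = l'.length) : l = l' := by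
  induction l generalizing j l' with
  | nil => exact (List.length_eq_zero_iff.1 hl.symm).symm
  | cons b l ih =>
    cases l' with
    | nil => simp at hl
    | cons b' l' => rw [← h.1, ← h'.1, ih h.2 h'.2 (by simpa using hl)]

theorem holds_replicate_false (j k : ℕ) :
    Holds (fun _ => false) j (List.replicate k false) := by
  induction k generalizing j with
  | zero => trivial
  | succ k ih => exact ⟨rfl, ih _⟩

/-- Write the bits of `l` into the cells `j, j + 1, …`. -/
def overwrite (g : ℕ → Bool) : ℕ → List Bool → ℕ → Bool
  | _, [] => g
  | j, b :: l => Function.update (overwrite g (j + 1) l) j b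

theorem Holds.update {g : ℕ → Bool} {j i : ℕ} {l : List Bool} {b : Bool} (h : Holds g j l)
    (hi : i < j) : Holds (Function.update g i b) j l := by
  induction l generalizing j with
  | nil => trivial
  | cons b' l ih =>
    exact ⟨(Function.update_of_ne hi.ne' _ _).trans h.1, ih h.2 (by omega)⟩

theorem holds_overwrite (g : ℕ → Bool) (j : ℕ) (l : List Bool) :
    Holds (overwrite g j l) j l := by
  induction l generalizing j with
  | nil => trivial
  | cons b l ih => exact ⟨Function.update_self _ _ _, (ih (j + 1)).update (Nat.lt_succ_self j)⟩

/-- Compare the bits of `l` with the next cells. -/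
def compareAll (l : List Bool) : List (Instr α) := l.map compare

open Classical in
theorem foldl_compareAll (l : List Bool) (s : Store w) :
    (compareAll l).foldl run s =
      ⟨if s.flag = .ready ∧ ¬Holds s.work s.head l then .failed else s.flag, s.pos,
        s.head + l.length, s.work⟩ := by
  induction l generalizing s with
  | nil => simp [compareAll, Holds]
  | cons b l ih =>
    change (compareAll l).foldl run (run s (compare b)) = _
    rw [ih]
    have h1 : run s (compare b) = ⟨if s.flag = .ready ∧ s.work s.head ≠ b then .failed else s.flag,
        s.pos, s.head + 1, s.work⟩ := by
      simp [run, exec, move, moveHead, AdviceTM.moveWork]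
    rw [h1]
    by_cases hf : s.flag = .ready
    · by_cases hb : s.work s.head = b
      · simp [hf, hb, Holds, add_assoc, add_comm 1]
      · simp [hf, hb, Holds, add_assoc, add_comm 1]
    · simp [hf, add_assoc, add_comm 1]

/-- The work head moves in the same way whether or not a comparison has failed, so the space bound
is a property of the program alone. -/
theorem staysBelow_compareAll {k j : ℕ} (l : List Bool) (h : j + l.length ≤ k) :
    StaysBelow k (compareAll l : List (Instr α)) j ∧
      (compareAll l : List (Instr α)).foldl (fun j I => AdviceTM.moveWork I.move j) j =
        j + l.length := by
  induction l generalizing j with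
  | nil => exact ⟨h, rfl⟩
  | cons b l ih =>
    rw [List.length_cons] at h ⊢
    have := ih (j := j + 1) (by omega)
    exact ⟨⟨by omega, this.1⟩, this.2.trans (by omega)⟩

/-- Write the bits of `l` from right to left, ending in the first cell. -/
def writeBack (l : List Bool) : List (Instr α) := l.reverse.flatMap fun b => [left, write b]

theorem writeBack_cons (b : Bool) (l : List Bool) :
    (writeBack (b :: l) : List (Instr α)) = writeBack l ++ [left, write b] := by
  simp [writeBack]

theorem length_writeBack (l : List Bool) :
    (writeBack l : List (Instr α)).length = 2 * l.length := by
  induction l with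
  | nil => rfl
  | cons b l ih =>
    rw [writeBack_cons, List.length_append, ih]
    simp
    ring

theorem foldl_writeBack (l : List Bool) (s : Store w) {j : ℕ} (hj : s.head = j + l.length) :
    (writeBack l).foldl run s =
      ⟨s.flag, s.pos, j, if s.flag = .ready then overwrite s.work j l else s.work⟩ := by
  induction l generalizing j with
  | nil =>
    obtain rfl : s.head = j := hj
    ext <;> simp [writeBack, overwrite]
  | cons b l ih =>
    rw [writeBack_cons, List.foldl_append,
      ih (j := j + 1) (by rw [hj, List.length_cons]; omega)]
    by_cases hf : s.flag = .ready <;>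
    simp [run, exec, move, moveHead, AdviceTM.moveWork, overwrite, hf]

theorem staysBelow_writeBack {k j : ℕ} (l : List Bool) (h : j + l.length ≤ k) :
    StaysBelow k (writeBack l : List (Instr α)) (j + l.length) ∧
      (writeBack l : List (Instr α)).foldl (fun j I => AdviceTM.moveWork I.move j)
        (j + l.length) = j := by
  induction l generalizing j with
  | nil => exact ⟨h, rfl⟩
  | cons b l ih =>
    rw [List.length_cons] at h ⊢
    have := ih (j := j + 1) (by omega)
    rw [writeBack_cons, show j + (l.length + 1) = j + 1 + l.length by omega]
    refine ⟨this.1.append this.2 ⟨by omega, ⟨?_, ?_⟩⟩, ?_⟩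
    · change j + 1 - 1 ≤ k
      omega
    · change j + 1 - 1 ≤ k
      omega
    · rw [List.foldl_append, this.2]
      rfl

/-- If the register holds `l` and the scanned symbol is `a`, replace `l` by `l'`, and advance. -/
def transition (l : List Bool) (a : α) (l' : List Bool) : List (Instr α) :=
  compareAll l ++ letter a :: (writeBack l' ++ [advance])

theorem length_transition (l : List Bool) (a : α) (l' : List Bool) :
    (transition l a l').length = l.length + 2 * l'.length + 2 := by
  simp [transition, compareAll, length_writeBack]
  ring

theorem staysBelow_transition {k : ℕ} {l l' : List Bool} (hl : l.length = k) (hl' : l'.length = k)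
    (a : α) : StaysBelow k (transition l a l') 0 ∧
      (transition l a l').foldl (fun j I => AdviceTM.moveWork I.move j) 0 = 0 := by
  have h1 := staysBelow_compareAll (α := α) (k := k) (j := 0) l (by omega)
  have h2 := staysBelow_writeBack (α := α) (k := k) (j := 0) l' (by omega)
  rw [zero_add, hl'] at h2
  rw [zero_add, hl] at h1
  refine ⟨h1.1.append h1.2 ⟨le_rfl, h2.1.append h2.2 ⟨Nat.zero_le k, Nat.zero_le k⟩⟩, ?_⟩
  rw [transition, List.foldl_append, h1.2, List.foldl_cons, List.foldl_append]
  change [advance].foldl (fun j I => AdviceTM.moveWork I.move j)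
    ((writeBack l' : List (Instr α)).foldl (fun j I => AdviceTM.moveWork I.move j) k) = 0
  rw [h2.2]
  rfl

-- A failed comparison disables the writes, and `advance` then clears the failure; thus a transition
-- that does not match leaves a ready store with its head in cell 0 unchanged.
open Classical in
theorem foldl_transition {l l' : List Bool} (hl : l.length = l'.length) (a : α) {s : Store w}
    (hs : s.head = 0) :
    (transition l a l').foldl run s =
      if s.flag = .ready ∧ Holds s.work 0 l ∧ tapeAt w s.pos = .symbol a then
        ⟨.done, moveHead .pos s.pos, 0, overwrite s.work 0 l'⟩
      else ⟨if s.flag = .failed then .ready else s.flag, s.pos, 0, s.work⟩ := by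
  obtain ⟨f, p, j, g⟩ := s
  obtain rfl : j = 0 := hs
  rw [transition, List.foldl_append, foldl_compareAll, List.foldl_cons, List.foldl_append,
    foldl_writeBack (j := 0) _ _ (by simp [run, move, AdviceTM.moveWork, hl])]
  cases f
  · by_cases h1 : Holds g 0 l <;> by_cases h2 : tapeAt w p = .symbol a <;>
    simp [h1, h2, run, exec, move, moveHead, AdviceTM.moveWork]
  all_goals simp [run, exec, move, moveHead, AdviceTM.moveWork]

/-- If the register holds `l`, accept. -/
def acceptIf (l : List Bool) : List (Instr α) :=
  compareAll l ++ accept :: (List.replicate l.length left ++ [reset])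

theorem length_acceptIf (l : List Bool) :
    (acceptIf l : List (Instr α)).length = 2 * l.length + 2 := by
  simp [acceptIf, compareAll]
  ring

theorem foldl_replicate_left (m : ℕ) (s : Store w) :
    (List.replicate m left).foldl run s = ⟨s.flag, s.pos, s.head - m, s.work⟩ := by
  induction m generalizing s with
  | zero => rfl
  | succ m ih =>
    rw [List.replicate_succ, List.foldl_cons, ih]
    ext <;> simp [run, exec, move, moveHead, AdviceTM.moveWork]
    omega

theorem staysBelow_replicate_left {k m : ℕ} (h : m ≤ k) :
    StaysBelow k (List.replicate m (left : Instr α)) m ∧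
      (List.replicate m (left : Instr α)).foldl (fun j I => AdviceTM.moveWork I.move j) m = 0 := by
  induction m with
  | zero => exact ⟨h, rfl⟩
  | succ m ih =>
    have := ih (by omega)
    exact ⟨⟨h, this.1⟩, this.2⟩

theorem staysBelow_acceptIf {k : ℕ} {l : List Bool} (hl : l.length = k) :
    StaysBelow k (acceptIf l : List (Instr α)) 0 ∧
      (acceptIf l : List (Instr α)).foldl (fun j I => AdviceTM.moveWork I.move j) 0 = 0 := by
  have h1 := staysBelow_compareAll (α := α) (k := k) (j := 0) l (by omega)
  have h2 := staysBelow_replicate_left (α := α) (le_refl k)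
  rw [zero_add, hl] at h1
  rw [acceptIf, hl]
  refine ⟨h1.1.append h1.2 ⟨le_rfl, h2.1.append h2.2 ⟨Nat.zero_le k, Nat.zero_le k⟩⟩, ?_⟩
  rw [List.foldl_append, h1.2, List.foldl_cons, List.foldl_append]
  change [reset].foldl (fun j I => AdviceTM.moveWork I.move j)
    ((List.replicate k (left : Instr α)).foldl (fun j I => AdviceTM.moveWork I.move j) k) = 0
  rw [h2.2]
  rfl

open Classical in
theorem foldl_acceptIf (l : List Bool) {s : Store w} (hs : s.head = 0) :
    (acceptIf l).foldl run s =
      ⟨if s.flag = .accepted ∨ s.flag = .ready ∧ Holds s.work 0 l then .accepted else .ready,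
        s.pos, 0, s.work⟩ := by
  obtain ⟨f, p, j, g⟩ := s
  obtain rfl : j = 0 := hs
  rw [acceptIf, List.foldl_append, foldl_compareAll, List.foldl_cons, List.foldl_append,
    foldl_replicate_left]
  cases f
  · by_cases h1 : Holds g 0 l <;>
    simp [h1, run, exec, move, moveHead, AdviceTM.moveWork]
  all_goals simp [run, exec, move, moveHead, AdviceTM.moveWork]

theorem staysBelow_flatMap {ι : Type*} {k : ℕ} {f : ι → List (Instr α)}
    (h : ∀ i, StaysBelow k (f i) 0 ∧ (f i).foldl (fun j I => AdviceTM.moveWork I.move j) 0 = 0)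
    (l : List ι) : StaysBelow k (l.flatMap f) 0 ∧
      (l.flatMap f).foldl (fun j I => AdviceTM.moveWork I.move j) 0 = 0 := by
  induction l with
  | nil => exact ⟨Nat.zero_le k, rfl⟩
  | cons i l ih =>
    rw [List.flatMap_cons]
    exact ⟨(h i).1.append (h i).2 ih.1, by rw [List.foldl_append, (h i).2, ih.2]⟩

end Instr

/-! ### Polynomially bounded functions -/

namespace IsPolyBounded

theorem mono {f g : ℕ → ℕ} (hg : IsPolyBounded g) (h : ∀ n, f n ≤ g n) : IsPolyBounded f := by
  obtain ⟨c, hc⟩ := hg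
  exact ⟨c, hc.mono fun n hn => (h n).trans hn⟩

theorem const (a : ℕ) : IsPolyBounded fun _ => a :=
  ⟨1, (Filter.eventually_ge_atTop a).mono fun n hn => by simpa using hn⟩

theorem id : IsPolyBounded fun n => n := ⟨1, Filter.Eventually.of_forall fun n => by simp⟩

theorem mul {f g : ℕ → ℕ} (hf : IsPolyBounded f) (hg : IsPolyBounded g) :
    IsPolyBounded fun n => f n * g n := by
  obtain ⟨c, hc⟩ := hf
  obtain ⟨d, hd⟩ := hg
  refine ⟨c + d, ?_⟩
  filter_upwards [hc, hd] with n h1 h2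
  rw [pow_add]
  exact Nat.mul_le_mul h1 h2

theorem add {f g : ℕ → ℕ} (hf : IsPolyBounded f) (hg : IsPolyBounded g) :
    IsPolyBounded fun n => f n + g n := by
  obtain ⟨c, hc⟩ := hf
  obtain ⟨d, hd⟩ := hg
  refine ⟨max c d + 1, ?_⟩
  filter_upwards [hc, hd, Filter.eventually_ge_atTop 2] with n h1 h2 h3
  have h4 := Nat.pow_le_pow_right (by omega : 0 < n) (le_max_left c d)
  have h5 := Nat.pow_le_pow_right (by omega : 0 < n) (le_max_right c d)
  rw [pow_succ]
  nlinarith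

theorem pow {f : ℕ → ℕ} (hf : IsPolyBounded f) (m : ℕ) : IsPolyBounded fun n => f n ^ m := by
  induction m with
  | zero => simpa using const 1
  | succ m ih => simpa only [pow_succ] using ih.mul hf

/-- If `2 ^ k n` is polynomially bounded then `k n` is logarithmically bounded. -/
theorem isBigO_log {k : ℕ → ℕ} (hk : IsPolyBounded fun n => 2 ^ k n) :
    (fun n => ((k n + 1 : ℕ) : ℝ)) =O[Filter.atTop] fun n : ℕ => Real.log n := by
  obtain ⟨c, hc⟩ := hk
  have hl : 0 < Real.log 2 := Real.log_pos one_lt_two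
  -- The extra `+ 1` in the constant pays for the additional cell, as `log 2 ≤ log n`.
  refine Asymptotics.IsBigO.of_bound ((c + 1) / Real.log 2) ?_
  filter_upwards [hc, Filter.eventually_ge_atTop 2] with n h1 h2
  have h2' : (2 : ℝ) ≤ n := by exact_mod_cast h2
  have h3 : Real.log 2 ≤ Real.log n := Real.log_le_log two_pos h2'
  have h4 : k n * Real.log 2 ≤ c * Real.log n := by
    rw [← Real.log_pow, ← Real.log_pow]
    exact Real.log_le_log (by positivity) (by exact_mod_cast h1)
  rw [Real.norm_of_nonneg (Nat.cast_nonneg _), Real.norm_of_nonneg (hl.le.trans h3),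
    div_mul_eq_mul_div, le_div_iff₀ hl]
  push_cast
  linarith

end IsPolyBounded

/-! ### The nonregularity of the languages in `BQP2QCFA` -/

section Nonregularity

variable {α : Type*}

theorem nonregularity_isPolyBounded_of_mem_BQP2QCFA {L : Language α} (hL : L ∈ BQP2QCFA α) :
    IsPolyBounded (nonregularity L) := by
  obtain ⟨T, hT, k, d, ε, -, -, -, hε, N, -, -, hN, htime⟩ := hL
  -- The gap `1 - 2 * ε` exceeds `3 / A`, while truncation and perturbation will cost at most `1 /
  -- A` each; `B` serves for the latter.
  obtain ⟨A, hA⟩ := exists_nat_gt (3 / (1 - 2 * ε))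
  obtain ⟨B, hB⟩ := exists_nat_gt (N.roundFactor * 2 * A)
  have hγ : 0 < 1 - 2 * ε := by linarith
  have hA0 : (0 : ℝ) < A := lt_trans (by positivity) hA
  have hB0 : (0 : ℝ) < B := lt_of_le_of_lt
    (mul_nonneg (mul_nonneg TwoQCFA.roundFactor_nonneg zero_le_two) hA0.le) hB
  have hA1 : 0 < A := by exact_mod_cast hA0
  have hB1 : 0 < B := by exact_mod_cast hB0
  have hbound (n : ℕ) : nonregularity L n ≤
      ((2 * (B * (A * (T n + 1) + 1)) + 1) * (2 * (B * (A * (T n + 1) + 1)) + 1)) ^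
        Fintype.card N.TransferIndex := by
    refine csSup_le ⟨0, Fin.elim0, fun i => i.elim0, fun i => i.elim0⟩ ?_
    rintro h ⟨x, -, hx⟩
    -- The cut-off `t = A (T n + 1)` is positive even if `T n = 0`, and the factor `t + 1` in the
    -- resolution `W = B (t + 1)` cancels the number of alternating runs.
    refine TwoQCFA.card_le_of_pairwise_dissimilar hN (htime n) (t := A * (T n + 1)) (by positivity)
      (by positivity) ?_ hx
    have h1 : (T n : ℝ) / (A * (T n + 1) : ℕ) ≤ 1 / A := by
      push_cast
      rw [div_le_div_iff₀ (by positivity) hA0]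
      nlinarith
    have h2 : (((A * (T n + 1) : ℕ) : ℝ) + 1) *
        (N.roundFactor * (2 / (B * (A * (T n + 1) + 1) : ℕ))) < 1 / A := by
      have h3 : (((A * (T n + 1) : ℕ) : ℝ) + 1) *
        (N.roundFactor * (2 / (B * (A * (T n + 1) + 1) : ℕ))) = N.roundFactor * 2 / B := by
        push_cast
        field_simp
      rw [h3, div_lt_div_iff₀ hB0 hA0, one_mul]
      exact hB
    have h4 : 3 / (A : ℝ) < 1 - 2 * ε := by
      rw [div_lt_iff₀ hγ] at hA
      rw [div_lt_iff₀ hA0]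
      linarith
    have h5 : 3 / (A : ℝ) = 1 / A + 1 / A + 1 / A := by ring
    have h6 : 0 < 1 / (A : ℝ) := by positivity
    linarith
  refine IsPolyBounded.mono ?_ hbound
  have h1 : IsPolyBounded fun n => 2 * (B * (A * (T n + 1) + 1)) + 1 :=
    ((IsPolyBounded.const 2).mul ((IsPolyBounded.const B).mul (((IsPolyBounded.const A).mul
      (hT.add (.const 1))).add (.const 1)))).add (.const 1)
  exact (h1.mul h1).pow _

/-! ### Residuals, and an automaton for each word length. -/

theorem card_le_nonregularity [Finite α] {L : Language α} {n h : ℕ} {x : Fin h → List α}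
    (hx : ∀ i, (x i).length ≤ n) (hd : ∀ i j, i ≠ j → Dissimilar L n (x i) (x j)) :
    h ≤ nonregularity L n := by
  -- The supremum is meaningful only for a bounded set, an unbounded one having supremum `0` in `ℕ`;
  -- dissimilar strings are distinct, and there are finitely many of length at most `n`.
  refine le_csSup ⟨Set.ncard {l : List α | l.length ≤ n}, ?_⟩ ⟨x, hx, hd⟩
  rintro h' ⟨x', hx', hd'⟩
  have hinj : Function.Injective x' := fun i j hij => by
    by_contra hne
    obtain ⟨y, -, hy⟩ := hd' i j hne
    rw [hij] at hy
    tauto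
  have := Set.ncard_le_ncard_of_injOn (s := Set.univ) x' (fun i _ => hx' i) hinj.injOn
    (List.finite_length_le α n)
  simpa [Set.ncard_univ] using this

/-- The continuations of `x` to words of length `n` in `L`. -/
def wordsAfter (L : Language α) (n : ℕ) (x : List α) : Set (List α) :=
  {y | x.length + y.length = n ∧ x ++ y ∈ L}

/-- The residuals of all words of length at most `n`. -/
def residuals (L : Language α) (n : ℕ) : Set (Set (List α)) :=
  wordsAfter L n '' {x | x.length ≤ n}

/-- For words of one length `i`, a continuation in just one of two residuals has length exactly `n -
i`, so it is short enough to witness dissimilarity. -/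
theorem ncard_residual_image_le [Finite α] (L : Language α) (n : ℕ) {i : ℕ} (hi : i ≤ n) :
    (wordsAfter L n '' {x | x.length = i}).ncard ≤ nonregularity L n := by
  have hfin : (wordsAfter L n '' {x | x.length = i}).Finite := (List.finite_length_eq α i).image _
  have : Fintype (wordsAfter L n '' {x | x.length = i} : Set _) := hfin.fintype
  have hcard : Fintype.card (wordsAfter L n '' {x | x.length = i} : Set _) =
      (wordsAfter L n '' {x | x.length = i}).ncard := by
    rw [← Nat.card_eq_fintype_card, Nat.card_coe_set_eq]
  rw [← hcard]
  let e := (Fintype.equivFin (wordsAfter L n '' {x | x.length = i} : Set _)).symm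
  choose x hx using fun j => (e j).2
  have hxl (j) : (x j).length = i := (hx j).1
  refine card_le_nonregularity (x := x) (fun j => (hxl j).le.trans hi) fun j j' hne => ?_
  have h1 : wordsAfter L n (x j) ≠ wordsAfter L n (x j') := by
    rw [(hx j).2, (hx j').2]
    exact fun h => hne (e.injective (Subtype.ext h))
  obtain ⟨y, hy⟩ : ∃ y, ¬(y ∈ wordsAfter L n (x j) ↔ y ∈ wordsAfter L n (x j')) := by
    by_contra! h
    exact h1 (Set.ext h)
  simp only [wordsAfter, Set.mem_ofPred_eq, hxl] at hy
  refine ⟨y, ?_, by tauto⟩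
  rw [hxl, hxl, max_self]
  by_contra hlt
  have : ¬(i + y.length = n) := by omega
  tauto

theorem finite_residuals [Finite α] (L : Language α) (n : ℕ) : (residuals L n).Finite :=
  (List.finite_length_le α n).image _

theorem ncard_residuals_le [Finite α] (L : Language α) (n : ℕ) :
    (residuals L n).ncard ≤ (n + 1) * nonregularity L n := by
  have h1 : residuals L n = ⋃ i ∈ Finset.range (n + 1), wordsAfter L n '' {x | x.length = i} := by
    ext S
    simp only [residuals, Set.mem_image, Set.mem_ofPred_eq, Set.mem_iUnion, Finset.mem_range]
    constructor
    · rintro ⟨x, hx, rfl⟩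
      exact ⟨x.length, by omega, x, rfl, rfl⟩
    · rintro ⟨i, hi, x, hx, rfl⟩
      exact ⟨x, by omega, rfl⟩
  rw [h1]
  refine (Finset.set_ncard_biUnion_le _ _).trans ?_
  refine (Finset.sum_le_card_nsmul _ _ (nonregularity L n) fun i hi =>
    ncard_residual_image_le L n (by rw [Finset.mem_range] at hi; omega)).trans ?_
  simp

/-- The words of length `n` in `L` are recognized by an automaton whose states are bit vectors, if
there are sufficiently many of these. -/
theorem exists_automaton [Finite α] (L : Language α) {n k : ℕ} (hk : (residuals L n).ncard ≤ 2 ^ k) :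
    ∃ (step : (Fin k → Bool) → α → Fin k → Bool) (acc : Set (Fin k → Bool)),
      ∀ w : List α, w.length = n → (w ∈ L ↔ w.foldl step (fun _ => false) ∈ acc) := by
  classical
  obtain ⟨f, -, hf⟩ := (finite_residuals L n).exists_injOn_of_encard_le
    (t := (Set.univ : Set (Fin k → Bool))) (by
      rw [← (finite_residuals L n).cast_ncard_eq, ← Set.finite_univ.cast_ncard_eq]
      rw [Set.ncard_univ]
      simpa using Nat.cast_le (α := ℕ∞).2 hk)
  -- The swap makes the all-false vector, which is what a blank work tape holds, the code of the
  -- initial residual.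
  let code : Set (List α) → Fin k → Bool :=
    fun S => Equiv.swap (f (wordsAfter L n [])) (fun _ => false) (f S)
  have hcode : Set.InjOn code (residuals L n) := (Equiv.injective _).comp_injOn hf
  have hstart : code (wordsAfter L n []) = fun _ => false := Equiv.swap_apply_left _ _
  have hinv {x : List α} (hx : x.length ≤ n) :
      Function.invFunOn code (residuals L n) (code (wordsAfter L n x)) = wordsAfter L n x :=
    hcode.leftInvOn_invFunOn ⟨x, hx, rfl⟩
  -- The residual of `x` determines that of `x` followed by `a`, by stripping a leading `a`. Vectors
  -- that encode no residual are never met on words of length at most `n`.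
  refine ⟨fun v a => code {y | a :: y ∈ Function.invFunOn code (residuals L n) v},
    {v | [] ∈ Function.invFunOn code (residuals L n) v}, fun w hw => ?_⟩
  have key (x : List α) (hx : x.length ≤ n) :
      x.foldl (fun v a => code {y | a :: y ∈ Function.invFunOn code (residuals L n) v})
        (fun _ => false) = code (wordsAfter L n x) := by
    induction x using List.reverseRecOn with
    | nil => exact hstart.symm
    | append_singleton x a ih =>
      rw [List.length_append, List.length_singleton] at hx
      rw [List.foldl_append, ih (by omega), List.foldl_cons, List.foldl_nil, hinv (by omega)]
      congr 1
      ext y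
      simp [wordsAfter, add_assoc, add_comm 1]
  rw [key w hw.le, Set.mem_ofPred_eq, hinv hw.le]
  simp [wordsAfter, hw]

end Nonregularity

/-! ### Simulating automata -/

namespace Instr

section Automaton

variable {α σ : Type*} [Fintype α] [Fintype σ] (code : σ → List Bool) (step : σ → α → σ)

/-- Simulate the given transitions of an automaton whose state is in the register. -/
def transitions (l : List (σ × α)) : List (Instr α) :=
  l.flatMap fun e => transition (code e.1) e.2 (code (step e.1 e.2))

/-- Simulate one step of an automaton whose state is in the register. -/
noncomputable def automatonStep : List (Instr α) :=
  transitions code step (Finset.univ : Finset (σ × α)).toList ++ [reset]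

/-- Accept if the register holds the code of one of the given states. -/
def acceptIfMem (l : List σ) : List (Instr α) := l.flatMap fun q => acceptIf (code q)

/-- Simulate `n` steps of an automaton whose initial state is in the register. -/
noncomputable def automatonProgram (acc : List σ) (n : ℕ) : List (Instr α) :=
  [advance, reset] ++ ((List.replicate n (automatonStep code step)).flatten ++ acceptIfMem code acc)

variable {code step} {k : ℕ} (hk : ∀ q, (code q).length = k) {w : List α}

include hk

theorem length_automatonProgram_le {acc : List σ} (hacc : acc.Nodup) (n : ℕ) :
    (automatonProgram code step acc n).length ≤
      2 + (n * (Fintype.card σ * Fintype.card α * (3 * k + 2) + 1) +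
        Fintype.card σ * (2 * k + 2)) := by
  have h1 : (automatonStep code step).length =
      Fintype.card σ * Fintype.card α * (3 * k + 2) + 1 := by
    rw [automatonStep, List.length_append, transitions, List.length_flatMap]
    simp only [length_transition, hk, List.map_const', List.sum_replicate, Finset.length_toList,
      Finset.card_univ, Fintype.card_prod, smul_eq_mul, List.length_singleton]
    ring
  have h2 : (acceptIfMem code acc : List (Instr α)).length = acc.length * (2 * k + 2) := by
    rw [acceptIfMem, List.length_flatMap]
    simp [length_acceptIf, hk]
  have h3 : acc.length ≤ Fintype.card σ := hacc.length_le_card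
  simp only [automatonProgram, List.length_append, List.length_flatten, List.map_replicate,
    List.sum_replicate, h1, h2, smul_eq_mul, List.length_cons, List.length_nil]
  gcongr

theorem staysBelow_automatonProgram (acc : List σ) (n : ℕ) :
    StaysBelow k (automatonProgram code step acc n) 0 := by
  have h1 : StaysBelow k (automatonStep code step) 0 ∧
      (automatonStep code step).foldl (fun j I => AdviceTM.moveWork I.move j) 0 = 0 := by
    have := staysBelow_flatMap (k := k)
      (fun e : σ × α => staysBelow_transition (hk e.1) (hk (step e.1 e.2)) e.2)
      (Finset.univ : Finset (σ × α)).toList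
    refine ⟨this.1.append this.2 ⟨Nat.zero_le k, Nat.zero_le k⟩, ?_⟩
    rw [automatonStep, transitions, List.foldl_append, this.2]
    rfl
  have h2 := staysBelow_flatMap (k := k) (fun _ : ℕ => h1) (List.replicate n 0)
  rw [List.flatMap_def, List.map_replicate] at h2
  have h3 := staysBelow_flatMap (α := α) (k := k) (fun q : σ => staysBelow_acceptIf (hk q)) acc
  exact ⟨Nat.zero_le k, Nat.zero_le k, h2.1.append h2.2 h3.1⟩

omit [Fintype α] [Fintype σ] in
theorem foldl_transitions_of_done (l : List (σ × α)) {s : Store w} (hs : s.head = 0)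
    (hf : s.flag = .done) : (transitions code step l).foldl run s = s := by
  induction l with
  | nil => rfl
  | cons e l ih =>
    rw [transitions, List.flatMap_cons, List.foldl_append,
      foldl_transition ((hk _).trans (hk _).symm) _ hs]
    obtain ⟨f, p, j, g⟩ := s
    simp only at hs hf
    subst hs hf
    simpa [transitions] using ih

-- Codes of equal length are told apart by the register, so only the entry `(q, a)` can match; after
-- it has fired the flag `done` blocks the rest.
omit [Fintype α] [Fintype σ] in
open Classical in
theorem foldl_transitions (hcode : Function.Injective code) (l : List (σ × α)) {s : Store w} {q : σ}
    {a : α} (hs : s.head = 0) (hf : s.flag = .ready) (hq : Holds s.work 0 (code q))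
    (ha : tapeAt w s.pos = .symbol a) :
    (transitions code step l).foldl run s =
      if (q, a) ∈ l then ⟨.done, moveHead .pos s.pos, 0, overwrite s.work 0 (code (step q a))⟩
      else s := by
  induction l with
  | nil => simp [transitions]
  | cons e l ih =>
    rw [transitions, List.flatMap_cons, List.foldl_append,
      foldl_transition ((hk _).trans (hk _).symm) _ hs]
    by_cases he : e = (q, a)
    · subst he
      rw [if_pos ⟨hf, hq, ha⟩, if_pos List.mem_cons_self]
      exact foldl_transitions_of_done hk l rfl rfl
    · rw [if_neg]
      · have : (⟨if s.flag = .failed then .ready else s.flag, s.pos, 0, s.work⟩ : Store w) = s := by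
          ext <;> simp [hf, hs]
        rw [this]
        simpa [Ne.symm he, transitions] using ih
      · rintro ⟨-, hq', ha'⟩
        apply he
        have h1 := hcode (hq'.eq_of_length_eq hq ((hk _).trans (hk _).symm))
        rw [ha] at ha'
        exact Prod.ext h1 (TapeSymbol.symbol.inj ha').symm

theorem foldl_automatonStep (hcode : Function.Injective code) {s : Store w} {q : σ}
    {a : α} (hs : s.head = 0) (hf : s.flag = .ready) (hq : Holds s.work 0 (code q))
    (ha : tapeAt w s.pos = .symbol a) :
    (automatonStep code step).foldl run s =
      ⟨.ready, moveHead .pos s.pos, 0, overwrite s.work 0 (code (step q a))⟩ := by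
  rw [automatonStep, List.foldl_append, foldl_transitions hk hcode _ hs hf hq ha,
    if_pos (Finset.mem_toList.2 (Finset.mem_univ _))]
  simp [run, exec, move, moveHead, AdviceTM.moveWork]

theorem foldl_automatonSteps (hcode : Function.Injective code) {s : Store w} {q : σ}
    (hs : s.head = 0) (hf : s.flag = .ready) (hq : Holds s.work 0 (code q))
    (hp : (s.pos : ℕ) = 1) {i : ℕ} (hi : i ≤ w.length) {s' : Store w}
    (hs' : s' = (List.replicate i (automatonStep code step)).flatten.foldl run s) :
    s'.head = 0 ∧ s'.flag = .ready ∧ (s'.pos : ℕ) = i + 1 ∧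
      Holds s'.work 0 (code ((w.take i).foldl step q)) := by
  induction i generalizing s' with
  | zero =>
    subst hs'
    exact ⟨hs, hf, hp, hq⟩
  | succ i ih =>
    obtain ⟨h1, h2, h3, h4⟩ := ih (by omega) rfl
    have ha : tapeAt w ((List.replicate i (automatonStep code step)).flatten.foldl run s).pos =
        .symbol w[i] := by
      rw [tapeAt, if_neg (by omega), h3, Nat.add_sub_cancel, List.getElem?_eq_getElem hi]
    rw [List.replicate_succ', List.flatten_append, List.foldl_append, List.flatten_singleton,
      foldl_automatonStep hk hcode h1 h2 h4 ha] at hs'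
    subst hs'
    refine ⟨rfl, rfl, ?_, ?_⟩
    · simp only [moveHead, h3]
      omega
    · rw [← List.take_append_getElem hi, List.foldl_append]
      exact holds_overwrite _ _ _

omit [Fintype α] [Fintype σ] in
theorem flag_foldl_acceptIfMem (hcode : Function.Injective code) (l : List σ) {s : Store w} {q : σ}
    (hs : s.head = 0) (hf : s.flag = .ready ∨ s.flag = .accepted)
    (hq : Holds s.work 0 (code q)) :
    ((acceptIfMem code l).foldl run s).flag = .accepted ↔ s.flag = .accepted ∨ q ∈ l := by
  classical
  induction l generalizing s with
  | nil => simp [acceptIfMem]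
  | cons q' l ih =>
    rw [acceptIfMem, List.flatMap_cons, List.foldl_append, foldl_acceptIf _ hs]
    have h1 : Holds s.work 0 (code q') ↔ q = q' :=
      ⟨fun h => hcode (hq.eq_of_length_eq h ((hk _).trans (hk _).symm)), fun h => h ▸ hq⟩
    refine (ih (s := ⟨if s.flag = .accepted ∨ s.flag = .ready ∧ Holds s.work 0 (code q') then
      .accepted else .ready, s.pos, 0, s.work⟩) rfl ?_ hq).trans ?_
    · simp only
      split_ifs <;> simp
    · simp only [h1, List.mem_cons]
      rcases hf with hf | hf <;> by_cases hqq : q = q' <;> simp [hf, hqq]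

theorem flag_foldl_automatonProgram (hcode : Function.Injective code) {q : σ}
    (hq : code q = List.replicate k false) (acc : List σ) (w : List α) :
    ((automatonProgram code step acc w.length).foldl run
      (Interpreter.initialStore w)).flag = .accepted ↔ w.foldl step q ∈ acc := by
  rw [automatonProgram, List.foldl_append, List.foldl_append]
  -- The opening pair moves the input head from the left end-marker to cell 1 and makes the flag
  -- ready again.
  have h0 : ([advance, reset] : List (Instr α)).foldl run (Interpreter.initialStore w) =
      ⟨.ready, ⟨1, by omega⟩, 0, fun _ => false⟩ := by
    simp [Interpreter.initialStore, run, exec, move, moveHead, AdviceTM.moveWork]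
  rw [h0]
  obtain ⟨h1, h2, -, h4⟩ := foldl_automatonSteps (step := step) hk hcode
    (s := (⟨.ready, ⟨1, by omega⟩, 0, fun _ => false⟩ : Store w)) rfl rfl
    (hq ▸ holds_replicate_false 0 k) rfl (le_refl w.length) rfl
  rw [List.take_length] at h4
  rw [flag_foldl_acceptIfMem hk hcode acc h1 (Or.inl h2) h4, h2]
  simp

end Automaton

end Instr

/-! ### From small automata to L/poly. -/

theorem mem_LPoly_of_automata {α : Type*} [Fintype α] {L : Language α} {k : ℕ → ℕ}
    (hk : IsPolyBounded fun n => 2 ^ k n) (step : ∀ n, (Fin (k n) → Bool) → α → Fin (k n) → Bool)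
    (acc : ∀ n, Set (Fin (k n) → Bool))
    (h : ∀ w : List α, w ∈ L ↔ w.foldl (step w.length) (fun _ => false) ∈ acc w.length) :
    L ∈ LPoly α := by
  classical
  let prog (n : ℕ) : List (Instr α) := Instr.automatonProgram List.ofFn (step n)
    (Finset.univ.filter (· ∈ acc n)).toList n
  have hlen (n : ℕ) (q : Fin (k n) → Bool) : (List.ofFn q).length = k n := List.length_ofFn
  refine ⟨Interpreter.machine α, fun n => (prog n).flatMap Interpreter.bits, fun n => k n + 1, ?_,
    hk.isBigO_log, fun w => ?_⟩
  · have h1 : IsPolyBounded k := hk.mono fun n => Nat.lt_two_pow_self.le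
    refine IsPolyBounded.mono (g := fun n => (2 + (n * (2 ^ k n * Fintype.card α * (3 * k n + 2) + 1)
      + 2 ^ k n * (2 * k n + 2))) * (Fintype.card (Instr α) + 1)) ?_ fun n => ?_
    · exact ((IsPolyBounded.const 2).add ((IsPolyBounded.id.mul (((hk.mul (.const _)).mul
        (((IsPolyBounded.const 3).mul h1).add (.const 2))).add (.const 1))).add
        (hk.mul (((IsPolyBounded.const 2).mul h1).add (.const 2))))).mul (.const _)
    · have h2 := Instr.length_automatonProgram_le (step := step n) (hlen n)
        (Finset.nodup_toList (Finset.univ.filter (· ∈ acc n))) n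
      rw [Fintype.card_fun, Fintype.card_bool, Fintype.card_fin] at h2
      rw [List.length_flatMap]
      refine (List.sum_le_card_nsmul _ (Fintype.card (Instr α) + 1) fun m hm => ?_).trans ?_
      · obtain ⟨I, -, rfl⟩ := List.mem_map.1 hm
        exact Interpreter.length_bits_le I
      · rw [List.length_map, smul_eq_mul]
        exact Nat.mul_le_mul_right _ h2
  · have h1 := Interpreter.machine_spec
      (Instr.staysBelow_automatonProgram (step := step w.length) (hlen w.length)
        (Finset.univ.filter (· ∈ acc w.length)).toList w.length) w
    have h2 := Instr.flag_foldl_automatonProgram (step := step w.length) (hlen w.length)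
      List.ofFn_injective (List.ofFn_const _ _)
      (Finset.univ.filter (· ∈ acc w.length)).toList w
    rw [Finset.mem_toList, Finset.mem_filter, and_iff_right (Finset.mem_univ _), ← h w] at h2
    exact ⟨h1.1, fun hw => h1.2.1 (h2.2 hw), fun hw => h1.2.2 (mt h2.1 hw)⟩

theorem BQP2QCFA_subset_LPoly {α : Type*} [Fintype α] : BQP2QCFA α ⊆ LPoly α := fun L hL => by
  have hD := nonregularity_isPolyBounded_of_mem_BQP2QCFA hL
  choose step acc h using fun n => exists_automaton L (Nat.le_pow_clog one_lt_two
    (residuals L n).ncard)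
  refine mem_LPoly_of_automata ?_ step acc fun w => h w.length w rfl
  -- Rounding up to a power of two at most doubles the number of residuals; the `+ 1` covers the
  -- case of at most one residual, where `k n = 0`.
  have h1 : IsPolyBounded fun n => 2 * ((n + 1) * nonregularity L n) + 1 :=
    ((IsPolyBounded.const 2).mul ((IsPolyBounded.id.add (.const 1)).mul hD)).add (.const 1)
  refine h1.mono fun n => ?_
  have h2 := ncard_residuals_le L n
  rcases Nat.lt_or_ge 1 (residuals L n).ncard with h3 | h3
  · have h4 := Nat.pow_pred_clog_lt_self one_lt_two h3
    have h5 : 0 < Nat.clog 2 (residuals L n).ncard := Nat.clog_pos one_lt_two h3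
    have h6 : 2 ^ Nat.clog 2 (residuals L n).ncard =
        2 * 2 ^ (Nat.clog 2 (residuals L n).ncard).pred := by
      rw [← pow_succ', Nat.pred_eq_sub_one, Nat.sub_add_cancel h5]
    omega
  · rw [Nat.clog_of_right_le_one h3]
    omega

theorem mainTheorem6 {α : Type*} [Fintype α] :
    (∀ L ∈ BQP2QCFA α, IsPolyBounded (nonregularity L)) ∧ BQP2QCFA α ⊆ LPoly α :=
  ⟨fun _ hL => nonregularity_isPolyBounded_of_mem_BQP2QCFA hL, BQP2QCFA_subset_LPoly⟩
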